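/- Notation. For a distribution $F=F(v)$, $v\in\mathbb R^3$, write $\langle\phi\rangle=\int_{\mathbb R^3}\phi\,dv$ and let $(\rho,\rho u,E)=\langle(1,v,\tfrac12|v|^2)F\rangle$, $E=\tfrac12\rho|u|^2+\tfrac32\rho RT$, $p=\rho RT$, $\Sigma(F)=\langle (v-u)\otimes(v-u)F\rangle$, $q(F)=\langle\tfrac12(v-u)|v-u|^2F\rangle$, $\Theta=\Sigma(F)/\rho$, $\Pi=(1-\nu)RT\,I+\nu\Theta$, and $$G(F)=\frac{\rho}{\sqrt{\det(2\pi\Pi)}}\exp\Bigl(-\tfrac12(v-u)\cdot\Pi^{-1}(v-u)\Bigr),\qquad D(F)=\frac1\tau\nabla_v\cdot\bigl((v-u)F+\Pi\nabla_vF\bigr).$$ Here $R>0$ and $\nu<1$ are constants ($R=1$ in non-dimensional variables). Let $\Omega\subset\mathbb R\times\mathbb R^3$ be open, $\varepsilon_0>0$, and for $0<\varepsilon<\varepsilon_0$ let $f=f^\varepsilon(t,x,v)$, $(t,x)\in\Omega$, $v\in\mathbb R^3$, be a classical solution of the ES-Fokker–Planck model with Knudsen number $\varepsilon$, $$\partial_tf+v\cdot\nabla_xf=\frac1\varepsilon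 D(f),$$ with relaxation time $\tau=\tau^\varepsilon(t,x)>0$ (equivalently, with physical relaxation time $\varepsilon\tau$). Below, $O(\cdot)$ is meant uniformly in $\varepsilon\in(0,\varepsilon_0)$ and locally uniformly on $\Omega$. Assume that $\tau$ and its first derivatives are $O(1)$, that $f$ is $C^2$ and $f$ and its derivatives in $(t,x,v)$ of order at most $2$ are $O(1)$ in every norm $\sup_v(1+|v|)^m|\cdot|$, that $\rho$ is locally bounded below by a positive constant independent of $\varepsilon$, that $\Pi$ is positive definite, and that $f=G(f)(1+\varepsilon g)$ with a deviation $g=g^\varepsilon$ of order one, in the sense that $G(f)g$ is $C^2$ and is $O(1)$ in the same norms, with its derivatives of order at most $2$. Then $\rho,u,T$ are $C^2$ on $\Omega$ and satisfy the compressible Navier–Stokes equations up to $O(\varepsilon^2)$: $$\partial_t\rho+\nabla\cdot(\rho u)=0,$$ $$\partial_t(\rho u)+\nabla\cdot(\rho u\otimes u)+\nabla p=-\nabla\cdot\sigma+O(\varepsilon^2),$$ $$\partial_tE+\nabla\cdot((E+p)u)=-\nabla\cdot q-\nabla\cdot(\sigma u)+O(\varepsilon^2),$$ $$\sigma=-\varepsilon\mu\bigl(\nabla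 u+(\nabla u)^T-\tfrac23(\nabla\cdot u)I\bigr),\quad q=-\varepsilon\kappa\nabla T,\qquad \mu=\frac{\tau p}{2(1-\nu)},\quad \kappa=\frac56\tau pR,$$ where moreover $\Sigma(f)=pI+\sigma+O(\varepsilon^2)$ and $q(f)=q+O(\varepsilon^2)$ (the factor $\varepsilon$ disappears if $\mu,\kappa$ are written with the physical relaxation time $\varepsilon\tau$). The Prandtl number is $$\Pr=\frac{\mu}{\kappa}\,\frac{5R}2=\frac{3}{2(1-\nu)}.$$ Furthermore, let $r>0$, $w\in\mathbb R^3$, $\theta>0$, let $M(v)=r(2\pi\theta)^{-3/2}\exp(-|v-w|^2/(2\theta))$ be the corresponding Maxwellian, $\mathcal Lh=\frac1M\nabla_v\cdot(\theta M\nabla_vh)$ the linearised operator (apart from the factor $1/\tau$), and $V=(v-w)/\sqrt\theta$. Then, for all $i,j$, the components of $A(V)=(\tfrac12|V|^2-\tfrac52)V$ and $B(V)=V\otimes V-\tfrac13|V|^2I$, as functions of $v$, satisfy $\mathcal LA_i=-3A_i$ and $\mathcal LB_{ij}=-2B_{ij}$. -/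

import Mathlib

open MeasureTheory Set

noncomputable section

namespace ESFP

/-- Position and velocity space `ℝ³` with its Euclidean norm and Lebesgue measure. -/
abbrev V3 := EuclideanSpace ℝ (Fin 3)

/-- Space-time `ℝ × ℝ³`, with points `z = (t, x)`. -/
abbrev SpaceTime := ℝ × V3

/-- The `i`-th vector of the canonical basis of `ℝ³`. -/
def e (i : Fin 3) : V3 := EuclideanSpace.single i 1

/-- `∂_t φ`. -/
def dt (φ : SpaceTime → ℝ) (z : SpaceTime) : ℝ := fderiv ℝ φ z (1, 0)

/-- `∂_{x_i} φ`. -/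
def dx (i : Fin 3) (φ : SpaceTime → ℝ) (z : SpaceTime) : ℝ := fderiv ℝ φ z (0, e i)

/-- `∂_{v_i} h`. -/
def dv (i : Fin 3) (h : V3 → ℝ) (v : V3) : ℝ := fderiv ℝ h v (e i)

/-! ### Macroscopic quantities of a velocity distribution `F` -/

/-- Mass density `ρ = ⟨F⟩`. -/
def density (F : V3 → ℝ) : ℝ := ∫ v, F v

/-- Bulk velocity `u`, given by `ρ u = ⟨v F⟩`. -/
def velocity (F : V3 → ℝ) : V3 := WithLp.toLp 2 fun i => (∫ v, v i * F v) / density F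

/-- Energy density `E = ⟨½ |v|² F⟩`. -/
def energy (F : V3 → ℝ) : ℝ := ∫ v, 1 / 2 * ‖v‖ ^ 2 * F v

/-- Temperature `T`, given by `E = ½ ρ |u|² + (3/2) ρ R T`. -/
def temperature (R : ℝ) (F : V3 → ℝ) : ℝ :=
  (energy F - 1 / 2 * density F * ‖velocity F‖ ^ 2) / (3 / 2 * density F * R)

/-- Pressure `p = ρ R T`. -/
def pressure (R : ℝ) (F : V3 → ℝ) : ℝ := density F * R * temperature R F

/-- Stress tensor `Σ(F) = ⟨(v - u) ⊗ (v - u) F⟩`. -/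
def stress (F : V3 → ℝ) (i j : Fin 3) : ℝ :=
  ∫ v, (v i - velocity F i) * (v j - velocity F j) * F v

/-- Heat flux `q(F) = ⟨½ (v - u) |v - u|² F⟩`. -/
def heatFlux (F : V3 → ℝ) (i : Fin 3) : ℝ :=
  ∫ v, 1 / 2 * (v i - velocity F i) * ‖v - velocity F‖ ^ 2 * F v

/-- Temperature tensor `Θ = (1/ρ) ⟨(v - u) ⊗ (v - u) F⟩`. -/
def Theta (F : V3 → ℝ) : Matrix (Fin 3) (Fin 3) ℝ :=
  Matrix.of fun i j => 1 / density F * stress F i j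

/-- `Π = (1 - ν) R T I + ν Θ`. -/
def PiTensor (R ν : ℝ) (F : V3 → ℝ) : Matrix (Fin 3) (Fin 3) ℝ :=
  ((1 - ν) * (R * temperature R F)) • (1 : Matrix (Fin 3) (Fin 3) ℝ) + ν • Theta F

/-- The anisotropic Gaussian `G(F)`. -/
def gaussian (R ν : ℝ) (F : V3 → ℝ) (v : V3) : ℝ :=
  density F / Real.sqrt (((2 * Real.pi) • PiTensor R ν F).det) *
    Real.exp (-(∑ i, ∑ j, (v i - velocity F i) * (PiTensor R ν F)⁻¹ i j *
      (v j - velocity F j)) / 2)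

/-- The ES-Fokker-Planck operator `D(F) = (1/τ) ∇_v · ((v - u) F + Π ∇_v F)`. -/
def collision (R ν τ : ℝ) (F : V3 → ℝ) (v : V3) : ℝ :=
  1 / τ * ∑ i, dv i (fun w => (w i - velocity F i) * F w +
    ∑ j, PiTensor R ν F i j * dv j F w) v

/-- `f` is a classical solution of `∂_t f + v · ∇_x f = (1/ε) D(f)` for `(t, x) ∈ Ω`, `v ∈ ℝ³`. -/
def IsSolution (R ν ε : ℝ) (τ : SpaceTime → ℝ) (Ω : Set SpaceTime)
    (f : SpaceTime → V3 → ℝ) : Prop :=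
  ∀ z ∈ Ω, ∀ v : V3,
    dt (fun y => f y v) z + ∑ i, v i * dx i (fun y => f y v) z =
      1 / ε * collision R ν (τ z) (f z) v

/-! ### Orders of magnitude, uniform in `ε ∈ (0, ε₀)` and locally uniform in `(t, x) ∈ Ω` -/

/-- The family `h ε` is an `O(1)` together with its derivatives of order at most `2` in `(t, x, v)`,
in every polynomially weighted sup norm in `v`. -/
def IsOOneKinetic (ε₀ : ℝ) (Ω : Set SpaceTime) (h : ℝ → SpaceTime → V3 → ℝ) : Prop :=
  (∀ ε ∈ Ioo 0 ε₀, ContDiffOn ℝ 2 (Function.uncurry (h ε)) (Ω ×ˢ univ)) ∧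
  ∀ K ⊆ Ω, IsCompact K → ∀ k ≤ 2, ∀ m : ℕ, ∃ C : ℝ, ∀ ε ∈ Ioo 0 ε₀, ∀ z ∈ K, ∀ v : V3,
    (1 + ‖v‖) ^ m * ‖iteratedFDeriv ℝ k (Function.uncurry (h ε)) (z, v)‖ ≤ C

/-- The family `a ε` of functions of `(t, x)` is an `O(1)` together with its first derivatives. -/
def IsOOneMacro (ε₀ : ℝ) (Ω : Set SpaceTime) (a : ℝ → SpaceTime → ℝ) : Prop :=
  (∀ ε ∈ Ioo 0 ε₀, ContDiffOn ℝ 1 (a ε) Ω) ∧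
  ∀ K ⊆ Ω, IsCompact K → ∀ k ≤ 1, ∃ C : ℝ, ∀ ε ∈ Ioo 0 ε₀, ∀ z ∈ K,
    ‖iteratedFDeriv ℝ k (a ε) z‖ ≤ C

/-- The family `a ε` is an `O(ε²)`. -/
def IsOEpsSq (ε₀ : ℝ) (Ω : Set SpaceTime) (a : ℝ → SpaceTime → ℝ) : Prop :=
  ∀ K ⊆ Ω, IsCompact K → ∃ C : ℝ, ∀ ε ∈ Ioo 0 ε₀, ∀ z ∈ K, |a ε z| ≤ C * ε ^ 2

/-! ### The compressible Navier-Stokes equations -/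

/-- `μ = τ p / (2 (1 - ν))`. -/
def viscosity (ν τ p : ℝ) : ℝ := τ * p / (2 * (1 - ν))

/-- `κ = (5/6) τ p R`. -/
def conductivity (R τ p : ℝ) : ℝ := 5 / 6 * τ * p * R

/-- Prandtl number `Pr = c_p μ / κ`, with `c_p = 5 R / 2` for a monoatomic gas. -/
def prandtl (R μ κ : ℝ) : ℝ := μ / κ * (5 * R / 2)

/-- `∇ · u`. -/
def divergence (u : SpaceTime → V3) (z : SpaceTime) : ℝ := ∑ k, dx k (fun y => u y k) z

/-- Newtonian shear stress `σ = -μ (∇u + (∇u)ᵀ - (2/3) (∇ · u) I)`. -/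
def shearStress (μ : SpaceTime → ℝ) (u : SpaceTime → V3) (i j : Fin 3) (z : SpaceTime) : ℝ :=
  -μ z * (dx j (fun y => u y i) z + dx i (fun y => u y j) z -
    2 / 3 * divergence u z * (if i = j then 1 else 0))

/-- Fourier heat flux `q = -κ ∇T`. -/
def fourierFlux (κ T : SpaceTime → ℝ) (i : Fin 3) (z : SpaceTime) : ℝ := -κ z * dx i T z

/-- `∂_t ρ + ∇ · (ρ u)`. -/
def massResidual (ρ : SpaceTime → ℝ) (u : SpaceTime → V3) (z : SpaceTime) : ℝ :=
  dt ρ z + ∑ j, dx j (fun y => ρ y * u y j) z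

/-- `i`-th component of `∂_t (ρ u) + ∇ · (ρ u ⊗ u) + ∇p + ∇ · σ`. -/
def momentumResidual (ρ : SpaceTime → ℝ) (u : SpaceTime → V3) (p : SpaceTime → ℝ)
    (σ : Fin 3 → Fin 3 → SpaceTime → ℝ) (i : Fin 3) (z : SpaceTime) : ℝ :=
  dt (fun y => ρ y * u y i) z + ∑ j, dx j (fun y => ρ y * u y i * u y j) z + dx i p z +
    ∑ j, dx j (σ i j) z

/-- `∂_t E + ∇ · ((E + p) u) + ∇ · q + ∇ · (σ u)`. -/
def energyResidual (E : SpaceTime → ℝ) (u : SpaceTime → V3) (p : SpaceTime → ℝ)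
    (σ : Fin 3 → Fin 3 → SpaceTime → ℝ) (q : Fin 3 → SpaceTime → ℝ) (z : SpaceTime) : ℝ :=
  dt E z + ∑ j, dx j (fun y => (E y + p y) * u y j) z + ∑ j, dx j (q j) z +
    ∑ j, dx j (fun y => ∑ k, σ j k y * u y k) z

/-! ### The linearised operator -/

/-- The Maxwellian with density `ρ`, velocity `u` and `θ = R T`. -/
def maxwellian (ρ : ℝ) (u : V3) (θ : ℝ) (v : V3) : ℝ :=
  ρ / (2 * Real.pi * θ) ^ (3 / 2 : ℝ) * Real.exp (-‖v - u‖ ^ 2 / (2 * θ))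

/-- `L g = (1/M) ∇_v · (θ M ∇_v g)`, with `M` the Maxwellian and `θ = R T`. -/
def linearised (ρ : ℝ) (u : V3) (θ : ℝ) (g : V3 → ℝ) (v : V3) : ℝ :=
  1 / maxwellian ρ u θ v * ∑ i, dv i (fun w => θ * maxwellian ρ u θ w * dv i g w) v

/-- `V = (v - u) / √θ`. -/
def scaled (u : V3) (θ : ℝ) (v : V3) : V3 := (1 / Real.sqrt θ) • (v - u)

/-- `A(V) = (|V|²/2 - 5/2) V`. -/
def vecA (i : Fin 3) (V : V3) : ℝ := (‖V‖ ^ 2 / 2 - 5 / 2) * V i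

/-- `B(V) = V ⊗ V - (1/3) |V|² I`. -/
def tensB (i j : Fin 3) (V : V3) : ℝ := V i * V j - 1 / 3 * ‖V‖ ^ 2 * (if i = j then 1 else 0)

end ESFP

end

open ESFP

open scoped Topology

namespace ESFP

variable {ε₀ : ℝ} {Ω : Set SpaceTime}

/-! ### Families of macroscopic fields -/

/-! The proof is a moment method: no linearised operator is inverted. Write c = v - u. Integrating
by parts, D(f) tested against a polynomial φ(c) is (1/τ)⟨(-c·∇φ + Π:∇²φ) f⟩, which involves no
moment of higher degree than φ (`KinO.moment_collision`). It vanishes for 1, c_i and |c|², giving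
exact conservation laws. For c_i c_j it equals -(2(1-ν)/τ)(Σ - pI), and for c_i|c|² it equals
-(3/τ)·2q (`stress_balance`, `heatFlux_balance`). These two rates alone determine μ, κ and the
Prandtl number.

Since the collision term carries 1/ε, solving these balances for Σ - pI and q gives ετ times their
transport side. That side is therefore needed only up to O(ε), which the ansatz f = G + εh provides.
The identity Π∇G = -(v-u)G turns integration by parts into a recursion for the moments of G: odd
moments vanish, second moments are Π⟨G⟩, fourth ones follow Isserlis' formula. As Π itself contains
Σ, the second moments give an implicit relation, (1-ν)(Σ - pI) = O(ε), solvable because ν < 1. Hence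
Σ = pI + O(ε), third moments are O(ε), and ⟨c_i c_j|c|²⟩ = 5pRT δ_ij + O(ε).

Inserting this in the transport side, and removing ∂_t p by the internal energy balance and the
acceleration by the momentum balance, gives the Newton and Fourier laws up to O(ε²)
(`orderO_stress_sub_newtonian`, `orderO_heatFlux_sub_fourier`). By the exact conservation laws, the
Navier–Stokes residuals are minus divergences built from the errors in these laws, hence O(ε²).

Derivatives are budgeted: moments start with two; one is spent in the transport side, the other in
the final divergence. The classes `MacroO`, `KinO` and `OrderO` do this bookkeeping; the first two
are defined recursively through directional derivatives, so that stability under algebraic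
operations follows by induction.

The eigenfunction statement is independent: in the variable V the operator becomes Δ - V·∇, and A, B
are Hermite polynomials of degrees 3 and 2. -/

/-- The family `a ε` is bounded, uniformly in `ε` and locally uniformly on `Ω`. -/
def LocBdd (ε₀ : ℝ) (Ω : Set SpaceTime) (a : ℝ → SpaceTime → ℝ) : Prop :=
  ∀ K ⊆ Ω, IsCompact K → ∃ C : ℝ, ∀ ε ∈ Ioo 0 ε₀, ∀ z ∈ K, |a ε z| ≤ C

/-- The family `a ε` is of class `C^n` and an `O(1)` with its derivatives of order at most `n`. -/
def MacroO (ε₀ : ℝ) (Ω : Set SpaceTime) : ℕ → (ℝ → SpaceTime → ℝ) → Prop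
  | 0, a => (∀ ε ∈ Ioo 0 ε₀, ContinuousOn (a ε) Ω) ∧ LocBdd ε₀ Ω a
  | n + 1, a => (∀ ε ∈ Ioo 0 ε₀, DifferentiableOn ℝ (a ε) Ω) ∧ LocBdd ε₀ Ω a ∧
      ∀ w, MacroO ε₀ Ω n (fun ε z => fderiv ℝ (a ε) z w)

theorem LocBdd.congr {a b : ℝ → SpaceTime → ℝ} (h : LocBdd ε₀ Ω a)
    (hab : ∀ ε ∈ Ioo 0 ε₀, ∀ z ∈ Ω, b ε z = a ε z) : LocBdd ε₀ Ω b := by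
  intro K hK hKc
  obtain ⟨C, hC⟩ := h K hK hKc
  exact ⟨C, fun ε hε z hz => by rw [hab ε hε z (hK hz)]; exact hC ε hε z hz⟩

theorem LocBdd.add {a b : ℝ → SpaceTime → ℝ} (ha : LocBdd ε₀ Ω a) (hb : LocBdd ε₀ Ω b) :
    LocBdd ε₀ Ω (fun ε z => a ε z + b ε z) := by
  intro K hK hKc
  obtain ⟨C, hC⟩ := ha K hK hKc
  obtain ⟨C', hC'⟩ := hb K hK hKc
  exact ⟨C + C', fun ε hε z hz =>
    (abs_add_le _ _).trans (add_le_add (hC ε hε z hz) (hC' ε hε z hz))⟩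

theorem LocBdd.mul {a b : ℝ → SpaceTime → ℝ} (ha : LocBdd ε₀ Ω a) (hb : LocBdd ε₀ Ω b) :
    LocBdd ε₀ Ω (fun ε z => a ε z * b ε z) := by
  intro K hK hKc
  obtain ⟨C, hC⟩ := ha K hK hKc
  obtain ⟨C', hC'⟩ := hb K hK hKc
  refine ⟨C * C', fun ε hε z hz => ?_⟩
  rw [abs_mul]
  exact mul_le_mul (hC ε hε z hz) (hC' ε hε z hz) (abs_nonneg _)
    ((abs_nonneg _).trans (hC ε hε z hz))

theorem LocBdd.inv {a : ℝ → SpaceTime → ℝ}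
    (ha : ∀ K ⊆ Ω, IsCompact K → ∃ c > 0, ∀ ε ∈ Ioo 0 ε₀, ∀ z ∈ K, c ≤ a ε z) :
    LocBdd ε₀ Ω (fun ε z => (a ε z)⁻¹) := by
  intro K hK hKc
  obtain ⟨c, hc, hC⟩ := ha K hK hKc
  refine ⟨c⁻¹, fun ε hε z hz => ?_⟩
  have h := hC ε hε z hz
  rw [abs_of_pos (inv_pos.2 (hc.trans_le h))]
  exact inv_anti₀ hc h

theorem MacroO.locBdd {n : ℕ} {a : ℝ → SpaceTime → ℝ} (h : MacroO ε₀ Ω n a) :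
    LocBdd ε₀ Ω a := by
  cases n with
  | zero => exact h.2
  | succ n => exact h.2.1

theorem MacroO.continuousOn {n : ℕ} {a : ℝ → SpaceTime → ℝ} (h : MacroO ε₀ Ω n a) :
    ∀ ε ∈ Ioo 0 ε₀, ContinuousOn (a ε) Ω := by
  cases n with
  | zero => exact h.1
  | succ n => exact fun ε hε => (h.1 ε hε).continuousOn

theorem MacroO.dir {n : ℕ} {a : ℝ → SpaceTime → ℝ} (h : MacroO ε₀ Ω (n + 1) a)
    (w : SpaceTime) : MacroO ε₀ Ω n (fun ε z => fderiv ℝ (a ε) z w) := h.2.2 w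

theorem MacroO.of_succ {n : ℕ} {a : ℝ → SpaceTime → ℝ} (h : MacroO ε₀ Ω (n + 1) a) :
    MacroO ε₀ Ω n a := by
  induction n generalizing a with
  | zero => exact ⟨h.continuousOn, h.locBdd⟩
  | succ n ih => exact ⟨h.1, h.2.1, fun w => ih (h.2.2 w)⟩

theorem MacroO.differentiableAt (hΩ : IsOpen Ω) {n : ℕ} {a : ℝ → SpaceTime → ℝ}
    (h : MacroO ε₀ Ω (n + 1) a) {ε : ℝ} (hε : ε ∈ Ioo 0 ε₀) {z : SpaceTime} (hz : z ∈ Ω) :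
    DifferentiableAt ℝ (a ε) z :=
  (h.1 ε hε).differentiableAt (hΩ.mem_nhds hz)

theorem fderiv_congr_of_isOpen {E F : Type*} [NormedAddCommGroup E] [NormedSpace ℝ E]
    [NormedAddCommGroup F] [NormedSpace ℝ F] {U : Set E} (hU : IsOpen U) {a b : E → F}
    (hab : ∀ z ∈ U, b z = a z) {z : E} (hz : z ∈ U) : fderiv ℝ b z = fderiv ℝ a z :=
  Filter.EventuallyEq.fderiv_eq (Filter.eventually_of_mem (hU.mem_nhds hz) hab)

theorem MacroO.congr (hΩ : IsOpen Ω) {n : ℕ} {a b : ℝ → SpaceTime → ℝ} (h : MacroO ε₀ Ω n a)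
    (hab : ∀ ε ∈ Ioo 0 ε₀, ∀ z ∈ Ω, b ε z = a ε z) : MacroO ε₀ Ω n b := by
  induction n generalizing a b with
  | zero => exact ⟨fun ε hε => (h.1 ε hε).congr (hab ε hε), h.2.congr hab⟩
  | succ n ih =>
    refine ⟨fun ε hε => (h.1 ε hε).congr (hab ε hε), h.2.1.congr hab, fun w => ?_⟩
    refine ih (h.2.2 w) fun ε hε z hz => ?_
    rw [fderiv_congr_of_isOpen hΩ (hab ε hε) hz]

theorem MacroO.const (c : ℝ → ℝ) {C : ℝ} (hc : ∀ ε ∈ Ioo 0 ε₀, |c ε| ≤ C) (n : ℕ) :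
    MacroO ε₀ Ω n (fun ε _ => c ε) := by
  induction n generalizing c C with
  | zero => exact ⟨fun ε _ => continuousOn_const, fun K _ _ => ⟨C, fun ε hε z _ => hc ε hε⟩⟩
  | succ n ih =>
    refine ⟨fun ε _ => differentiableOn_const _, fun K _ _ => ⟨C, fun ε hε z _ => hc ε hε⟩, ?_⟩
    intro w
    simpa using ih (fun _ => 0) (C := 0) (by simp)

theorem MacroO.add (hΩ : IsOpen Ω) {n : ℕ} {a b : ℝ → SpaceTime → ℝ} (ha : MacroO ε₀ Ω n a)
    (hb : MacroO ε₀ Ω n b) : MacroO ε₀ Ω n (fun ε z => a ε z + b ε z) := by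
  induction n generalizing a b with
  | zero => exact ⟨fun ε hε => (ha.1 ε hε).add (hb.1 ε hε), ha.2.add hb.2⟩
  | succ n ih =>
    refine ⟨fun ε hε => (ha.1 ε hε).add (hb.1 ε hε), ha.2.1.add hb.2.1, fun w => ?_⟩
    refine (ih (ha.2.2 w) (hb.2.2 w)).congr hΩ fun ε hε z hz => ?_
    rw [fderiv_fun_add (ha.differentiableAt hΩ hε hz) (hb.differentiableAt hΩ hε hz)]
    rfl

theorem fderiv_mul_dir {E : Type*} [NormedAddCommGroup E] [NormedSpace ℝ E] {a b : E → ℝ} {z : E}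
    (ha : DifferentiableAt ℝ a z) (hb : DifferentiableAt ℝ b z) (w : E) :
    fderiv ℝ (fun y => a y * b y) z w =
      fderiv ℝ a z w * b z + a z * fderiv ℝ b z w := by
  rw [fderiv_fun_mul ha hb]
  simp [mul_comm, add_comm]

theorem MacroO.mul (hΩ : IsOpen Ω) {n : ℕ} {a b : ℝ → SpaceTime → ℝ} (ha : MacroO ε₀ Ω n a)
    (hb : MacroO ε₀ Ω n b) : MacroO ε₀ Ω n (fun ε z => a ε z * b ε z) := by
  induction n generalizing a b with
  | zero => exact ⟨fun ε hε => (ha.1 ε hε).mul (hb.1 ε hε), ha.2.mul hb.2⟩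
  | succ n ih =>
    refine ⟨fun ε hε => (ha.1 ε hε).mul (hb.1 ε hε), ha.2.1.mul hb.2.1, fun w => ?_⟩
    refine ((ih (ha.2.2 w) hb.of_succ).add hΩ (ih ha.of_succ (hb.2.2 w))).congr hΩ
      fun ε hε z hz => ?_
    exact fderiv_mul_dir (ha.differentiableAt hΩ hε hz) (hb.differentiableAt hΩ hε hz) w

theorem MacroO.const_mul (hΩ : IsOpen Ω) {n : ℕ} {a : ℝ → SpaceTime → ℝ} (c : ℝ)
    (ha : MacroO ε₀ Ω n a) : MacroO ε₀ Ω n (fun ε z => c * a ε z) :=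
  (MacroO.const (fun _ => c) (C := |c|) (fun _ _ => le_rfl) n).mul hΩ ha

theorem pos_of_locally_bounded_below {a : ℝ → SpaceTime → ℝ}
    (hpos : ∀ K ⊆ Ω, IsCompact K → ∃ c > 0, ∀ ε ∈ Ioo 0 ε₀, ∀ z ∈ K, c ≤ a ε z)
    {ε : ℝ} (hε : ε ∈ Ioo 0 ε₀) {z : SpaceTime} (hz : z ∈ Ω) : 0 < a ε z := by
  obtain ⟨c, hc, h⟩ := hpos {z} (by simpa using hz) isCompact_singleton
  exact hc.trans_le (h ε hε z rfl)

theorem MacroO.inv (hΩ : IsOpen Ω) {n : ℕ} {a : ℝ → SpaceTime → ℝ} (ha : MacroO ε₀ Ω n a)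
    (hpos : ∀ K ⊆ Ω, IsCompact K → ∃ c > 0, ∀ ε ∈ Ioo 0 ε₀, ∀ z ∈ K, c ≤ a ε z) :
    MacroO ε₀ Ω n (fun ε z => (a ε z)⁻¹) := by
  have hne : ∀ ε ∈ Ioo 0 ε₀, ∀ z ∈ Ω, a ε z ≠ 0 := fun ε hε z hz =>
    (pos_of_locally_bounded_below hpos hε hz).ne'
  induction n with
  | zero => exact ⟨fun ε hε => (ha.1 ε hε).inv₀ (hne ε hε), LocBdd.inv hpos⟩
  | succ n ih =>
    refine ⟨fun ε hε => (ha.1 ε hε).inv (hne ε hε), LocBdd.inv hpos, fun w => ?_⟩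
    have hi := ih ha.of_succ
    -- The derivative of 1/a is -(1/a)² a', where 1/a is needed only to order n, so the induction
    -- hypothesis covers it.
    refine (((hi.mul hΩ hi).mul hΩ (ha.2.2 w)).const_mul hΩ (-1)).congr hΩ fun ε hε z hz => ?_
    have hd := (hasDerivAt_inv (hne ε hε z hz)).comp_hasFDerivAt z
      (ha.differentiableAt hΩ hε hz).hasFDerivAt
    refine (DFunLike.congr_fun hd.fderiv w).trans ?_
    simp [pow_two]

theorem MacroO.sum (hΩ : IsOpen Ω) {ι : Type*} {n : ℕ} (s : Finset ι)
    {a : ι → ℝ → SpaceTime → ℝ} (ha : ∀ i, MacroO ε₀ Ω n (a i)) :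
    MacroO ε₀ Ω n (fun ε z => ∑ i ∈ s, a i ε z) := by
  classical
  induction s using Finset.induction_on with
  | empty => simpa using MacroO.const (fun _ => 0) (C := 0) (by simp) n
  | insert i s hi ih =>
    simp only [Finset.sum_insert hi]
    exact (ha i).add hΩ ih

theorem MacroO.contDiffOn (hΩ : IsOpen Ω) {n : ℕ} {a : ℝ → SpaceTime → ℝ}
    (h : MacroO ε₀ Ω n a) {ε : ℝ} (hε : ε ∈ Ioo 0 ε₀) : ContDiffOn ℝ n (a ε) Ω := by
  induction n generalizing a with
  | zero => exact contDiffOn_zero.2 (h.1 ε hε)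
  | succ n ih =>
    push_cast
    rw [contDiffOn_succ_iff_fderiv_apply hΩ.uniqueDiffOn]
    refine ⟨h.1 ε hε, by simp, fun w => (ih (h.2.2 w)).congr fun z hz => ?_⟩
    rw [fderivWithin_of_isOpen hΩ hz]

theorem IsOOneMacro.macroO (hΩ : IsOpen Ω) {a : ℝ → SpaceTime → ℝ} (h : IsOOneMacro ε₀ Ω a) :
    MacroO ε₀ Ω 1 a := by
  refine ⟨fun ε hε => (h.1 ε hε).differentiableOn (by norm_num), ?_, fun w => ⟨?_, ?_⟩⟩
  · intro K hK hKc
    simpa using h.2 K hK hKc 0 (by norm_num)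
  · intro ε hε
    exact ((h.1 ε hε).continuousOn_fderiv_of_isOpen hΩ (by norm_num)).clm_apply
      continuousOn_const
  · intro K hK hKc
    obtain ⟨C, hC⟩ := h.2 K hK hKc 1 le_rfl
    refine ⟨C * ‖w‖, fun ε hε z hz => ?_⟩
    refine ((fderiv ℝ (a ε) z).le_opNorm w).trans ?_
    rw [← norm_iteratedFDeriv_one]
    exact mul_le_mul_of_nonneg_right (hC ε hε z hz) (norm_nonneg _)

/-! ### Orders in `ε` -/

/-- The family `a ε` is an `O(ε ^ k)` with its derivatives of order at most `n`. -/
def OrderO (ε₀ : ℝ) (Ω : Set SpaceTime) (k n : ℕ) (a : ℝ → SpaceTime → ℝ) : Prop :=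
  MacroO ε₀ Ω n (fun ε z => ε⁻¹ ^ k * a ε z)

theorem MacroO.orderO {n : ℕ} {a : ℝ → SpaceTime → ℝ} (h : MacroO ε₀ Ω n a) :
    OrderO ε₀ Ω 0 n a := by
  simpa [OrderO] using h

section order

variable {k l n : ℕ} {a b : ℝ → SpaceTime → ℝ}

theorem OrderO.congr (hΩ : IsOpen Ω) (h : OrderO ε₀ Ω k n a)
    (hab : ∀ ε ∈ Ioo 0 ε₀, ∀ z ∈ Ω, b ε z = a ε z) : OrderO ε₀ Ω k n b :=
  MacroO.congr hΩ h fun ε hε z hz => by rw [hab ε hε z hz]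

theorem OrderO.add (hΩ : IsOpen Ω) (ha : OrderO ε₀ Ω k n a) (hb : OrderO ε₀ Ω k n b) :
    OrderO ε₀ Ω k n (fun ε z => a ε z + b ε z) :=
  (MacroO.add hΩ ha hb).congr hΩ fun ε _ z _ => by ring

theorem OrderO.mul (hΩ : IsOpen Ω) (ha : OrderO ε₀ Ω k n a) (hb : OrderO ε₀ Ω l n b) :
    OrderO ε₀ Ω (k + l) n (fun ε z => a ε z * b ε z) :=
  (MacroO.mul hΩ ha hb).congr hΩ fun ε _ z _ => by ring

theorem OrderO.mul_macroO (hΩ : IsOpen Ω) (ha : OrderO ε₀ Ω k n a) (hb : MacroO ε₀ Ω n b) :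
    OrderO ε₀ Ω k n (fun ε z => a ε z * b ε z) :=
  OrderO.mul hΩ ha hb.orderO

theorem OrderO.const_mul (hΩ : IsOpen Ω) (c : ℝ) (ha : OrderO ε₀ Ω k n a) :
    OrderO ε₀ Ω k n (fun ε z => c * a ε z) :=
  (MacroO.const_mul hΩ c ha).congr hΩ fun ε _ z _ => by ring

theorem OrderO.sub (hΩ : IsOpen Ω) (ha : OrderO ε₀ Ω k n a) (hb : OrderO ε₀ Ω k n b) :
    OrderO ε₀ Ω k n (fun ε z => a ε z - b ε z) :=
  (ha.add hΩ (hb.const_mul hΩ (-1))).congr hΩ fun ε _ z _ => by ring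

theorem OrderO.sum (hΩ : IsOpen Ω) {ι : Type*} (s : Finset ι)
    {a : ι → ℝ → SpaceTime → ℝ} (ha : ∀ i, OrderO ε₀ Ω k n (a i)) :
    OrderO ε₀ Ω k n (fun ε z => ∑ i ∈ s, a i ε z) :=
  (MacroO.sum hΩ s ha).congr hΩ fun ε _ z _ => by rw [Finset.mul_sum]

theorem OrderO.eps_mul (hΩ : IsOpen Ω) (ha : OrderO ε₀ Ω k n a) :
    OrderO ε₀ Ω (k + 1) n (fun ε z => ε * a ε z) := by
  refine MacroO.congr hΩ ha fun ε hε z _ => ?_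
  have : ε ≠ 0 := hε.1.ne'
  rw [pow_succ]
  field_simp

theorem macroO_eps (n : ℕ) : MacroO ε₀ Ω n (fun ε _ => ε) :=
  MacroO.const (fun ε => ε) (C := ε₀) (fun ε hε => by
    rw [abs_of_pos hε.1]; exact hε.2.le) n

/-- Powers of ε can be discarded because ε < ε₀. This recovers differentiability of the unscaled
family. -/
theorem OrderO.macroO (hΩ : IsOpen Ω) (ha : OrderO ε₀ Ω k n a) : MacroO ε₀ Ω n a := by
  induction k with
  | zero => simpa [OrderO] using ha
  | succ k ih =>
    refine ih ((MacroO.mul hΩ (macroO_eps n) ha).congr hΩ fun ε hε z _ => ?_)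
    have : ε ≠ 0 := hε.1.ne'
    rw [pow_succ]
    field_simp

theorem OrderO.dir (hΩ : IsOpen Ω) (ha : OrderO ε₀ Ω k (n + 1) a) (w : SpaceTime) :
    OrderO ε₀ Ω k n (fun ε z => fderiv ℝ (a ε) z w) := by
  have h := ha.macroO hΩ
  refine (MacroO.dir ha w).congr hΩ fun ε hε z hz => ?_
  rw [fderiv_const_mul (h.differentiableAt hΩ hε hz)]
  rfl

theorem OrderO.of_succ (ha : OrderO ε₀ Ω k (n + 1) a) : OrderO ε₀ Ω k n a :=
  MacroO.of_succ ha

theorem OrderO.isOEpsSq (ha : OrderO ε₀ Ω 2 n a) : IsOEpsSq ε₀ Ω a := by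
  intro K hK hKc
  obtain ⟨C, hC⟩ := ha.locBdd K hK hKc
  refine ⟨C, fun ε hε z hz => ?_⟩
  have h := hC ε hε z hz
  have : 0 < ε := hε.1
  rw [abs_mul, abs_of_pos (by positivity), inv_pow, inv_mul_le_iff₀ (by positivity)] at h
  linarith

end order

/-! ### Families of rapidly decaying kinetic functions -/

/-- The family `h ε` is an `O(1)` in every polynomially weighted sup norm in `v`. -/
def DecayO (ε₀ : ℝ) (Ω : Set SpaceTime) (h : ℝ → SpaceTime → V3 → ℝ) : Prop :=
  ∀ K ⊆ Ω, IsCompact K → ∀ m : ℕ, ∃ C : ℝ, ∀ ε ∈ Ioo 0 ε₀, ∀ z ∈ K, ∀ v : V3,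
    (1 + ‖v‖) ^ m * |h ε z v| ≤ C

/-- The family `h ε` is of class `C^n` and, with its derivatives of order at most `n`, an `O(1)` in
every polynomially weighted sup norm in `v`. -/
def KinO (ε₀ : ℝ) (Ω : Set SpaceTime) : ℕ → (ℝ → SpaceTime → V3 → ℝ) → Prop
  | 0, h => (∀ ε ∈ Ioo 0 ε₀, ContinuousOn (Function.uncurry (h ε)) (Ω ×ˢ univ)) ∧
      DecayO ε₀ Ω h
  | n + 1, h => (∀ ε ∈ Ioo 0 ε₀, DifferentiableOn ℝ (Function.uncurry (h ε)) (Ω ×ˢ univ)) ∧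
      DecayO ε₀ Ω h ∧
      ∀ w, KinO ε₀ Ω n (fun ε z v => fderiv ℝ (Function.uncurry (h ε)) (z, v) w)

theorem DecayO.congr {h k : ℝ → SpaceTime → V3 → ℝ} (hh : DecayO ε₀ Ω h)
    (hk : ∀ ε ∈ Ioo 0 ε₀, ∀ z ∈ Ω, ∀ v, k ε z v = h ε z v) : DecayO ε₀ Ω k := by
  intro K hK hKc m
  obtain ⟨C, hC⟩ := hh K hK hKc m
  exact ⟨C, fun ε hε z hz v => by rw [hk ε hε z (hK hz)]; exact hC ε hε z hz v⟩

theorem DecayO.add {h k : ℝ → SpaceTime → V3 → ℝ} (hh : DecayO ε₀ Ω h) (hk : DecayO ε₀ Ω k) :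
    DecayO ε₀ Ω (fun ε z v => h ε z v + k ε z v) := by
  intro K hK hKc m
  obtain ⟨C, hC⟩ := hh K hK hKc m
  obtain ⟨C', hC'⟩ := hk K hK hKc m
  refine ⟨C + C', fun ε hε z hz v => ?_⟩
  refine (mul_le_mul_of_nonneg_left (abs_add_le _ _) (by positivity)).trans ?_
  rw [mul_add]
  exact add_le_add (hC ε hε z hz v) (hC' ε hε z hz v)

theorem DecayO.macro_mul {a : ℝ → SpaceTime → ℝ} {h : ℝ → SpaceTime → V3 → ℝ}
    (ha : LocBdd ε₀ Ω a) (hh : DecayO ε₀ Ω h) : DecayO ε₀ Ω (fun ε z v => a ε z * h ε z v) := by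
  intro K hK hKc m
  obtain ⟨C, hC⟩ := ha K hK hKc
  obtain ⟨C', hC'⟩ := hh K hK hKc m
  refine ⟨C * C', fun ε hε z hz v => ?_⟩
  rw [abs_mul, mul_left_comm]
  exact mul_le_mul (hC ε hε z hz) (hC' ε hε z hz v) (by positivity)
    ((abs_nonneg _).trans (hC ε hε z hz))

/-- A factor v_i costs one power of the weight, which is harmless since every power is available. -/
theorem DecayO.coord_mul {h : ℝ → SpaceTime → V3 → ℝ} (i : Fin 3) (hh : DecayO ε₀ Ω h) :
    DecayO ε₀ Ω (fun ε z v => v i * h ε z v) := by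
  intro K hK hKc m
  obtain ⟨C, hC⟩ := hh K hK hKc (m + 1)
  refine ⟨C, fun ε hε z hz v => le_trans ?_ (hC ε hε z hz v)⟩
  have hv : |v i| ≤ 1 + ‖v‖ := by
    have := PiLp.norm_apply_le v i
    rw [Real.norm_eq_abs] at this
    linarith
  rw [abs_mul, pow_succ, mul_assoc]
  gcongr

theorem KinO.decay {n : ℕ} {h : ℝ → SpaceTime → V3 → ℝ} (hh : KinO ε₀ Ω n h) :
    DecayO ε₀ Ω h := by
  cases n with
  | zero => exact hh.2
  | succ n => exact hh.2.1

theorem KinO.continuousOn {n : ℕ} {h : ℝ → SpaceTime → V3 → ℝ} (hh : KinO ε₀ Ω n h) :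
    ∀ ε ∈ Ioo 0 ε₀, ContinuousOn (Function.uncurry (h ε)) (Ω ×ˢ univ) := by
  cases n with
  | zero => exact hh.1
  | succ n => exact fun ε hε => (hh.1 ε hε).continuousOn

theorem KinO.dir {n : ℕ} {h : ℝ → SpaceTime → V3 → ℝ} (hh : KinO ε₀ Ω (n + 1) h)
    (w : SpaceTime × V3) :
    KinO ε₀ Ω n (fun ε z v => fderiv ℝ (Function.uncurry (h ε)) (z, v) w) := hh.2.2 w

theorem KinO.of_succ {n : ℕ} {h : ℝ → SpaceTime → V3 → ℝ} (hh : KinO ε₀ Ω (n + 1) h) :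
    KinO ε₀ Ω n h := by
  induction n generalizing h with
  | zero => exact ⟨hh.continuousOn, hh.decay⟩
  | succ n ih => exact ⟨hh.1, hh.2.1, fun w => ih (hh.2.2 w)⟩

theorem KinO.differentiableAt (hΩ : IsOpen Ω) {n : ℕ} {h : ℝ → SpaceTime → V3 → ℝ}
    (hh : KinO ε₀ Ω (n + 1) h) {ε : ℝ} (hε : ε ∈ Ioo 0 ε₀) {z : SpaceTime} (hz : z ∈ Ω) (v : V3) :
    DifferentiableAt ℝ (Function.uncurry (h ε)) (z, v) :=
  (hh.1 ε hε).differentiableAt ((hΩ.prod isOpen_univ).mem_nhds ⟨hz, mem_univ _⟩)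

theorem KinO.congr (hΩ : IsOpen Ω) {n : ℕ} {h k : ℝ → SpaceTime → V3 → ℝ}
    (hh : KinO ε₀ Ω n h) (hk : ∀ ε ∈ Ioo 0 ε₀, ∀ z ∈ Ω, ∀ v, k ε z v = h ε z v) :
    KinO ε₀ Ω n k := by
  have hu : ∀ ε ∈ Ioo 0 ε₀, ∀ x ∈ Ω ×ˢ (univ : Set V3),
      Function.uncurry (k ε) x = Function.uncurry (h ε) x :=
    fun ε hε x hx => hk ε hε x.1 hx.1 x.2
  induction n generalizing h k with
  | zero => exact ⟨fun ε hε => (hh.1 ε hε).congr (hu ε hε), hh.2.congr hk⟩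
  | succ n ih =>
    refine ⟨fun ε hε => (hh.1 ε hε).congr (hu ε hε), hh.2.1.congr hk, fun w => ?_⟩
    have key : ∀ ε ∈ Ioo 0 ε₀, ∀ z ∈ Ω, ∀ v, fderiv ℝ (Function.uncurry (k ε)) (z, v) w =
        fderiv ℝ (Function.uncurry (h ε)) (z, v) w := fun ε hε z hz v => by
      rw [fderiv_congr_of_isOpen (hΩ.prod isOpen_univ) (hu ε hε) ⟨hz, mem_univ _⟩]
    exact ih (hh.2.2 w) key fun ε hε x hx => key ε hε x.1 hx.1 x.2

theorem KinO.add (hΩ : IsOpen Ω) {n : ℕ} {h k : ℝ → SpaceTime → V3 → ℝ} (hh : KinO ε₀ Ω n h)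
    (hk : KinO ε₀ Ω n k) : KinO ε₀ Ω n (fun ε z v => h ε z v + k ε z v) := by
  induction n generalizing h k with
  | zero => exact ⟨fun ε hε => (hh.1 ε hε).add (hk.1 ε hε), hh.2.add hk.2⟩
  | succ n ih =>
    refine ⟨fun ε hε => (hh.1 ε hε).add (hk.1 ε hε), hh.2.1.add hk.2.1, fun w => ?_⟩
    refine (ih (hh.2.2 w) (hk.2.2 w)).congr hΩ fun ε hε z hz v => ?_
    exact DFunLike.congr_fun
      (fderiv_add (hh.differentiableAt hΩ hε hz v) (hk.differentiableAt hΩ hε hz v)) w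

theorem KinO.macro_mul (hΩ : IsOpen Ω) {n : ℕ} {a : ℝ → SpaceTime → ℝ}
    {h : ℝ → SpaceTime → V3 → ℝ} (ha : MacroO ε₀ Ω n a) (hh : KinO ε₀ Ω n h) :
    KinO ε₀ Ω n (fun ε z v => a ε z * h ε z v) := by
  induction n generalizing a h with
  | zero =>
    exact ⟨fun ε hε => ((ha.1 ε hε).comp continuousOn_fst fun x hx => hx.1).mul (hh.1 ε hε),
      hh.2.macro_mul ha.2⟩
  | succ n ih =>
    refine ⟨fun ε hε => ((ha.1 ε hε).comp differentiableOn_fst fun x hx => hx.1).mul (hh.1 ε hε),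
      hh.2.1.macro_mul ha.2.1, fun w => ?_⟩
    refine ((ih (ha.2.2 w.1) hh.of_succ).add hΩ (ih ha.of_succ (hh.2.2 w))).congr hΩ
      fun ε hε z hz v => ?_
    have hd : HasFDerivAt (a ε ∘ Prod.fst) ((fderiv ℝ (a ε) z).comp
        (ContinuousLinearMap.fst ℝ SpaceTime V3)) (z, v) :=
      HasFDerivAt.comp (z, v) (f := Prod.fst) (ha.differentiableAt hΩ hε hz).hasFDerivAt
        hasFDerivAt_fst
    refine (fderiv_mul_dir (a := a ε ∘ Prod.fst) hd.differentiableAt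
      (hh.differentiableAt hΩ hε hz v) w).trans ?_
    rw [hd.fderiv]
    rfl

theorem hasFDerivAt_coord_snd (i : Fin 3) (x : SpaceTime × V3) :
    HasFDerivAt (fun y : SpaceTime × V3 => y.2 i)
      ((EuclideanSpace.proj i : V3 →L[ℝ] ℝ).comp (ContinuousLinearMap.snd ℝ SpaceTime V3)) x :=
  ((EuclideanSpace.proj i : V3 →L[ℝ] ℝ).comp
    (ContinuousLinearMap.snd ℝ SpaceTime V3)).hasFDerivAt

theorem KinO.coord_mul (hΩ : IsOpen Ω) {n : ℕ} {h : ℝ → SpaceTime → V3 → ℝ} (i : Fin 3)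
    (hh : KinO ε₀ Ω n h) : KinO ε₀ Ω n (fun ε z v => v i * h ε z v) := by
  have hd : Differentiable ℝ (fun y : SpaceTime × V3 => y.2 i) :=
    fun x => (hasFDerivAt_coord_snd i x).differentiableAt
  induction n generalizing h with
  | zero => exact ⟨fun ε hε => hd.continuous.continuousOn.mul (hh.1 ε hε), hh.2.coord_mul i⟩
  | succ n ih =>
    refine ⟨fun ε hε => hd.differentiableOn.mul (hh.1 ε hε), hh.2.1.coord_mul i, fun w => ?_⟩
    refine ((KinO.macro_mul hΩ (MacroO.const (fun _ => w.2 i) (C := |w.2 i|)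
      (fun _ _ => le_rfl) n) hh.of_succ).add hΩ (ih (hh.2.2 w))).congr hΩ fun ε hε z hz v => ?_
    refine (fderiv_mul_dir (hd _) (hh.differentiableAt hΩ hε hz v) w).trans ?_
    rw [(hasFDerivAt_coord_snd i _).fderiv]
    rfl

theorem KinO.const_mul (hΩ : IsOpen Ω) {n : ℕ} {h : ℝ → SpaceTime → V3 → ℝ} (c : ℝ)
    (hh : KinO ε₀ Ω n h) : KinO ε₀ Ω n (fun ε z v => c * h ε z v) :=
  KinO.macro_mul hΩ (MacroO.const (fun _ => c) (C := |c|) (fun _ _ => le_rfl) n) hh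

theorem IsOOneKinetic.kinO (hΩ : IsOpen Ω) {h : ℝ → SpaceTime → V3 → ℝ}
    (hh : IsOOneKinetic ε₀ Ω h) : KinO ε₀ Ω 2 h := by
  have hU : IsOpen (Ω ×ˢ (univ : Set V3)) := hΩ.prod isOpen_univ
  have hd : ∀ ε ∈ Ioo 0 ε₀, ∀ w, ContDiffOn ℝ 1
      (fun x => fderiv ℝ (Function.uncurry (h ε)) x w) (Ω ×ˢ univ) := fun ε hε w =>
    ((hh.1 ε hε).fderiv_of_isOpen hU (by norm_num)).clm_apply contDiffOn_const
  refine ⟨fun ε hε => (hh.1 ε hε).differentiableOn (by norm_num), ?_, fun w =>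
    ⟨fun ε hε => (hd ε hε w).differentiableOn (by norm_num), ?_, fun w' => ⟨fun ε hε =>
      ((hd ε hε w).continuousOn_fderiv_of_isOpen hU (by norm_num)).clm_apply
        continuousOn_const, ?_⟩⟩⟩
  · intro K hK hKc m
    simpa using hh.2 K hK hKc 0 (by norm_num) m
  · intro K hK hKc m
    obtain ⟨C, hC⟩ := hh.2 K hK hKc 1 (by norm_num) m
    refine ⟨C * ‖w‖, fun ε hε z hz v => ?_⟩
    refine le_trans ?_ (mul_le_mul_of_nonneg_right (hC ε hε z hz v) (norm_nonneg w))
    rw [norm_iteratedFDeriv_one, mul_assoc]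
    exact mul_le_mul_of_nonneg_left ((fderiv ℝ (Function.uncurry (h ε)) (z, v)).le_opNorm w)
      (by positivity)
  · intro K hK hKc m
    obtain ⟨C, hC⟩ := hh.2 K hK hKc 2 le_rfl m
    refine ⟨C * (‖w'‖ * ‖w‖), fun ε hε z hz v => ?_⟩
    refine le_trans ?_ (mul_le_mul_of_nonneg_right (hC ε hε z hz v)
      (mul_nonneg (norm_nonneg w') (norm_nonneg w)))
    rw [mul_assoc]
    refine mul_le_mul_of_nonneg_left ?_ (by positivity)
    have hdd : DifferentiableAt ℝ (fderiv ℝ (Function.uncurry (h ε))) (z, v) :=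
      (((hh.1 ε hε).fderiv_of_isOpen hU (m := 1) (by norm_num)).differentiableOn
        (by norm_num)).differentiableAt (hU.mem_nhds ⟨hK hz, mem_univ _⟩)
    -- Two nested directional derivatives are the second derivative evaluated on the pair of
    -- directions, the outer one first.
    have h1 : fderiv ℝ (Function.uncurry fun z v => fderiv ℝ (Function.uncurry (h ε)) (z, v) w)
        (z, v) w' = iteratedFDeriv ℝ 2 (Function.uncurry (h ε)) (z, v) ![w', w] := by
      rw [iteratedFDeriv_two_apply]
      refine (DFunLike.congr_fun (hdd.hasFDerivAt.clm_apply
        (hasFDerivAt_const w (z, v))).fderiv w').trans ?_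
      simp
    refine (congrArg abs h1).trans_le ?_
    refine ((iteratedFDeriv ℝ 2 (Function.uncurry (h ε)) (z, v)).le_opNorm _).trans ?_
    simp [Fin.prod_univ_two]

/-! ### Integrals in `v` -/

/-- The exponent 4 is the least integer exceeding the dimension 3, so the majorant is integrable. -/
theorem DecayO.exists_bound {h : ℝ → SpaceTime → V3 → ℝ} (hh : DecayO ε₀ Ω h) {K : Set SpaceTime}
    (hK : K ⊆ Ω) (hKc : IsCompact K) : ∃ C : ℝ, ∀ ε ∈ Ioo 0 ε₀, ∀ z ∈ K, ∀ v : V3,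
      ‖h ε z v‖ ≤ C * (1 + ‖v‖) ^ (-(4 : ℝ)) := by
  obtain ⟨C, hC⟩ := hh K hK hKc 4
  refine ⟨C, fun ε hε z hz v => ?_⟩
  have h1 : 0 < 1 + ‖v‖ := by positivity
  have h2 : (1 + ‖v‖) ^ (-(4 : ℝ)) = ((1 + ‖v‖) ^ 4)⁻¹ := by
    rw [Real.rpow_neg h1.le]
    norm_cast
  rw [h2, ← div_eq_mul_inv, le_div_iff₀ (by positivity), mul_comm]
  exact hC ε hε z hz v

theorem integrable_decay_bound (C : ℝ) :
    Integrable (fun v : V3 => C * (1 + ‖v‖) ^ (-(4 : ℝ))) :=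
  (integrable_one_add_norm (by simp; norm_num)).const_mul C

theorem KinO.continuous {n : ℕ} {h : ℝ → SpaceTime → V3 → ℝ} (hh : KinO ε₀ Ω n h) {ε : ℝ}
    (hε : ε ∈ Ioo 0 ε₀) {z : SpaceTime} (hz : z ∈ Ω) : Continuous (h ε z) :=
  continuousOn_univ.1 ((hh.continuousOn ε hε).comp (f := fun v => (z, v)) (by fun_prop)
    fun v _ => ⟨hz, mem_univ _⟩)

theorem KinO.integrable {n : ℕ} {h : ℝ → SpaceTime → V3 → ℝ} (hh : KinO ε₀ Ω n h) {ε : ℝ}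
    (hε : ε ∈ Ioo 0 ε₀) {z : SpaceTime} (hz : z ∈ Ω) : Integrable (h ε z) := by
  obtain ⟨C, hC⟩ := hh.decay.exists_bound (K := {z}) (by simpa using hz) isCompact_singleton
  exact (integrable_decay_bound C).mono' (hh.continuous hε hz).aestronglyMeasurable
    (Filter.Eventually.of_forall (hC ε hε z rfl))

theorem LocBdd.integral {h : ℝ → SpaceTime → V3 → ℝ} (hh : DecayO ε₀ Ω h) :
    LocBdd ε₀ Ω (fun ε z => ∫ v, h ε z v) := by
  intro K hK hKc
  obtain ⟨C, hC⟩ := hh.exists_bound hK hKc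
  exact ⟨_, fun ε hε z hz => norm_integral_le_of_norm_le (integrable_decay_bound C)
    (Filter.Eventually.of_forall (hC ε hε z hz))⟩

/-- Domination under the integral needs an operator norm, whereas `KinO` controls one direction at a
time; the four basis directions suffice. -/
theorem norm_le_of_dir (L : SpaceTime →L[ℝ] ℝ) :
    ‖L‖ ≤ |L (1, 0)| + ∑ i, |L (0, e i)| := by
  refine L.opNorm_le_bound (by positivity) fun w => ?_
  have hw : w = w.1 • ((1, 0) : SpaceTime) + ∑ i, w.2 i • ((0, e i) : SpaceTime) := by
    refine Prod.ext (by simp [Prod.fst_sum]) ?_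
    ext j
    simp [Prod.snd_sum, e, Finset.sum_apply, Pi.single_apply]
  have h2 : ∀ i, |w.2 i| ≤ ‖w‖ := fun i =>
    (PiLp.norm_apply_le w.2 i).trans (norm_snd_le w)
  conv_lhs => rw [hw]
  rw [map_add, map_sum, add_mul, Finset.sum_mul]
  refine (norm_add_le _ _).trans (add_le_add ?_ ((norm_sum_le _ _).trans
    (Finset.sum_le_sum fun i _ => ?_)))
  · rw [map_smul, norm_smul, mul_comm]
    exact mul_le_mul_of_nonneg_left (norm_fst_le w) (norm_nonneg _)
  · rw [map_smul, norm_smul, mul_comm]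
    exact mul_le_mul_of_nonneg_left (h2 i) (norm_nonneg _)

/-- Differentiation under the integral sign: on a compact neighbourhood of z the decay is uniform,
which supplies the dominating function. -/
theorem KinO.hasFDerivAt_integral (hΩ : IsOpen Ω) {n : ℕ} {h : ℝ → SpaceTime → V3 → ℝ}
    (hh : KinO ε₀ Ω (n + 1) h) {ε : ℝ} (hε : ε ∈ Ioo 0 ε₀) {z : SpaceTime} (hz : z ∈ Ω) :
    DifferentiableAt ℝ (fun y => ∫ v, h ε y v) z ∧ ∀ w,
      fderiv ℝ (fun y => ∫ v, h ε y v) z w =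
        ∫ v, fderiv ℝ (Function.uncurry (h ε)) (z, v) (w, 0) := by
  obtain ⟨K, hKc, hzK, hK⟩ := exists_compact_subset hΩ hz
  set F' : SpaceTime → V3 → SpaceTime →L[ℝ] ℝ := fun y v =>
    (fderiv ℝ (Function.uncurry (h ε)) (y, v)).comp (ContinuousLinearMap.inl ℝ SpaceTime V3)
    with hF'
  have hF'w : ∀ y v w, F' y v w = fderiv ℝ (Function.uncurry (h ε)) (y, v) (w, 0) :=
    fun y v w => rfl
  choose C hC using fun w : SpaceTime => (hh.dir (w, 0)).decay.exists_bound hK hKc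
  have hcont : Continuous (F' z) := continuous_clm_apply.2 fun w =>
    (hh.dir (w, 0)).continuous hε hz
  have hbound : ∀ y ∈ K, ∀ v, ‖F' y v‖ ≤
      (C (1, 0) + ∑ i, C (0, e i)) * (1 + ‖v‖) ^ (-(4 : ℝ)) := by
    intro y hy v
    refine (norm_le_of_dir _).trans ?_
    rw [add_mul, Finset.sum_mul]
    exact add_le_add (hC _ ε hε y hy v) (Finset.sum_le_sum fun i _ => hC _ ε hε y hy v)
  have hK' : K ∈ 𝓝 z := mem_interior_iff_mem_nhds.1 hzK
  have hder : HasFDerivAt (fun y => ∫ v, h ε y v) (∫ v, F' z v) z := by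
    refine hasFDerivAt_integral_of_dominated_of_fderiv_le (F := fun y v => h ε y v) (F' := F') hK'
      (Filter.eventually_of_mem hK' fun y hy =>
        (hh.continuous hε (hK hy)).aestronglyMeasurable)
      (hh.integrable hε hz) hcont.aestronglyMeasurable
      (Filter.Eventually.of_forall fun v y hy => hbound y hy v) (integrable_decay_bound _)
      (Filter.Eventually.of_forall fun v y hy => ?_)
    exact HasFDerivAt.comp y (f := fun y => (y, v))
      (hh.differentiableAt hΩ hε (hK hy) v).hasFDerivAt (hasFDerivAt_prodMk_left y v)
  have hint : Integrable (F' z) :=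
    (integrable_decay_bound _).mono' hcont.aestronglyMeasurable
      (Filter.Eventually.of_forall (hbound z (interior_subset hzK)))
  refine ⟨hder.differentiableAt, fun w => ?_⟩
  rw [hder.fderiv, ContinuousLinearMap.integral_apply hint]
  rfl

theorem KinO.integral (hΩ : IsOpen Ω) {n : ℕ} {h : ℝ → SpaceTime → V3 → ℝ}
    (hh : KinO ε₀ Ω n h) : MacroO ε₀ Ω n (fun ε z => ∫ v, h ε z v) := by
  induction n generalizing h with
  | zero =>
    refine ⟨fun ε hε z hz => ContinuousAt.continuousWithinAt ?_, LocBdd.integral hh.2⟩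
    obtain ⟨K, hKc, hzK, hK⟩ := exists_compact_subset hΩ hz
    have hK' : K ∈ 𝓝 z := mem_interior_iff_mem_nhds.1 hzK
    obtain ⟨C, hC⟩ := hh.decay.exists_bound hK hKc
    refine continuousAt_of_dominated
      (Filter.eventually_of_mem hK' fun y hy => (hh.continuous hε (hK hy)).aestronglyMeasurable)
      (Filter.eventually_of_mem hK' fun y hy => Filter.Eventually.of_forall (hC ε hε y hy))
      (integrable_decay_bound C) (Filter.Eventually.of_forall fun v => ?_)
    exact ((hh.1 ε hε).continuousAt ((hΩ.prod isOpen_univ).mem_nhds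
      ⟨hz, mem_univ v⟩)).comp (f := fun y => (y, v)) (by fun_prop)
  | succ n ih =>
    refine ⟨fun ε hε z hz =>
      (hh.hasFDerivAt_integral hΩ hε hz).1.differentiableWithinAt, LocBdd.integral hh.2.1,
      fun w => ?_⟩
    exact (ih (hh.2.2 (w, 0))).congr hΩ fun ε hε z hz =>
      (hh.hasFDerivAt_integral hΩ hε hz).2 w

theorem KinO.hasFDerivAt_velocity (hΩ : IsOpen Ω) {n : ℕ} {h : ℝ → SpaceTime → V3 → ℝ}
    (hh : KinO ε₀ Ω (n + 1) h) {ε : ℝ} (hε : ε ∈ Ioo 0 ε₀) {z : SpaceTime} (hz : z ∈ Ω) (v : V3) :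
    HasFDerivAt (h ε z) ((fderiv ℝ (Function.uncurry (h ε)) (z, v)).comp
      (ContinuousLinearMap.inr ℝ SpaceTime V3)) v :=
  (hh.differentiableAt hΩ hε hz v).hasFDerivAt.comp v (hasFDerivAt_prodMk_right z v)

theorem KinO.dv_eq (hΩ : IsOpen Ω) {n : ℕ} {h : ℝ → SpaceTime → V3 → ℝ}
    (hh : KinO ε₀ Ω (n + 1) h) {ε : ℝ} (hε : ε ∈ Ioo 0 ε₀) {z : SpaceTime} (hz : z ∈ Ω) (v : V3)
    (i : Fin 3) : dv i (h ε z) v = fderiv ℝ (Function.uncurry (h ε)) (z, v) (0, e i) := by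
  rw [dv, (hh.hasFDerivAt_velocity hΩ hε hz v).fderiv]
  rfl

theorem KinO.dv (hΩ : IsOpen Ω) {n : ℕ} {h : ℝ → SpaceTime → V3 → ℝ}
    (hh : KinO ε₀ Ω (n + 1) h) (i : Fin 3) : KinO ε₀ Ω n (fun ε z v => dv i (h ε z) v) :=
  (hh.dir (0, e i)).congr hΩ fun _ hε _ hz v => hh.dv_eq hΩ hε hz v i

theorem KinO.fderiv_left_eq (hΩ : IsOpen Ω) {n : ℕ} {h : ℝ → SpaceTime → V3 → ℝ}
    (hh : KinO ε₀ Ω (n + 1) h) {ε : ℝ} (hε : ε ∈ Ioo 0 ε₀) {z : SpaceTime} (hz : z ∈ Ω) (v : V3)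
    (w : SpaceTime) : fderiv ℝ (fun y => h ε y v) z w =
      fderiv ℝ (Function.uncurry (h ε)) (z, v) (w, 0) := by
  have := HasFDerivAt.comp z (f := fun y => (y, v))
    (hh.differentiableAt hΩ hε hz v).hasFDerivAt (hasFDerivAt_prodMk_left z v)
  exact DFunLike.congr_fun this.fderiv w

/-- Integration by parts against the constant 1; integrability of the function and of its derivative
rules out boundary terms. -/
theorem KinO.integral_dv (hΩ : IsOpen Ω) {n : ℕ} {h : ℝ → SpaceTime → V3 → ℝ}
    (hh : KinO ε₀ Ω (n + 1) h) {ε : ℝ} (hε : ε ∈ Ioo 0 ε₀) {z : SpaceTime} (hz : z ∈ Ω)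
    (i : Fin 3) : ∫ v, ESFP.dv i (h ε z) v = 0 := by
  have := integral_bilinear_hasFDerivAt_right_eq_neg_left_of_integrable (μ := volume)
    (f := fun _ : V3 => (1 : ℝ)) (f' := fun _ => 0) (g := h ε z) (g' := fun v => fderiv ℝ (h ε z) v)
    (v := e i) (B := ContinuousLinearMap.mul ℝ ℝ) (by simp)
    (by simpa [ESFP.dv] using (hh.dv hΩ i).integrable hε hz) (by simpa using hh.integrable hε hz)
    (fun x _ => hasFDerivAt_const _ _)
    (fun v _ => (hh.hasFDerivAt_velocity hΩ hε hz v).differentiableAt.hasFDerivAt)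
  simpa [ESFP.dv] using this

-- The chain rule for polynomials in differentiable functions reduces all later derivatives of
-- weights to the algebraic `pderiv`.
open MvPolynomial in
theorem hasFDerivAt_eval {E σ : Type*} [NormedAddCommGroup E] [NormedSpace ℝ E] [Fintype σ]
    {x : σ → E → ℝ} {x' : σ → E →L[ℝ] ℝ} {y : E} (hx : ∀ i, HasFDerivAt (x i) (x' i) y)
    (φ : MvPolynomial σ ℝ) :
    HasFDerivAt (fun y => eval (fun i => x i y) φ)
      (∑ i, eval (fun i => x i y) (pderiv i φ) • x' i) y := by
  classical
  induction φ using MvPolynomial.induction_on with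
  | C a => simpa using hasFDerivAt_const a y
  | add p q hp hq =>
    simp only [map_add]
    exact (hp.fun_add hq).congr_fderiv (by simp [add_smul, Finset.sum_add_distrib])
  | mul_X p i hp =>
    simp only [map_mul, eval_X]
    refine (hp.fun_mul (hx i)).congr_fderiv ?_
    simp [Derivation.leibniz, pderiv_X, add_smul, Finset.sum_add_distrib, Pi.single_apply,
      Finset.smul_sum, smul_smul, apply_ite, ite_smul]

/-! ### Centred polynomial weights and moments -/

/-- The polynomial weight `φ(v - u)`. -/
noncomputable def centred (u : V3) (φ : MvPolynomial (Fin 3) ℝ) (v : V3) : ℝ :=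
  MvPolynomial.eval (fun i => v i - u i) φ

/-- The moment `⟨φ(v - u) F⟩`. -/
noncomputable def moment (u : V3) (F : V3 → ℝ) (φ : MvPolynomial (Fin 3) ℝ) : ℝ := ∫ v, centred u φ v * F v

/-- All polynomial moments of `F` exist. -/
def HasMoments (F : V3 → ℝ) : Prop := ∀ u φ, Integrable fun v => centred u φ v * F v

open MvPolynomial

theorem hasFDerivAt_centred (u : V3) (φ : MvPolynomial (Fin 3) ℝ) (v : V3) :
    HasFDerivAt (centred u φ)
      (∑ i, centred u (pderiv i φ) v • (EuclideanSpace.proj i : V3 →L[ℝ] ℝ)) v :=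
  hasFDerivAt_eval (x := fun i (v : V3) => v i - u i)
    (x' := fun i => (EuclideanSpace.proj i : V3 →L[ℝ] ℝ))
    (fun i => (EuclideanSpace.proj i : V3 →L[ℝ] ℝ).hasFDerivAt.sub_const (u i)) φ

theorem dv_centred (u : V3) (φ : MvPolynomial (Fin 3) ℝ) (l : Fin 3) (v : V3) :
    dv l (centred u φ) v = centred u (pderiv l φ) v := by
  rw [dv, (hasFDerivAt_centred u φ v).fderiv]
  simp [e]

section moments

variable {F H : V3 → ℝ} {u : V3} {φ ψ : MvPolynomial (Fin 3) ℝ}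

theorem moment_add (hF : HasMoments F) : moment u F (φ + ψ) = moment u F φ + moment u F ψ := by
  rw [moment, moment, moment, ← integral_add (hF u φ) (hF u ψ)]
  simp [centred, add_mul]

theorem moment_C_mul (c : ℝ) : moment u F (C c * φ) = c * moment u F φ := by
  rw [moment, moment, ← integral_const_mul]
  simp [centred, mul_assoc]

theorem moment_C (c : ℝ) : moment u F (C c) = c * moment u F 1 := by
  rw [← moment_C_mul, mul_one]

theorem moment_zero : moment u F 0 = 0 := by simp [moment, centred]

theorem moment_sum (hF : HasMoments F) {ι : Type*} (s : Finset ι)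
    (φ : ι → MvPolynomial (Fin 3) ℝ) :
    moment u F (∑ i ∈ s, φ i) = ∑ i ∈ s, moment u F (φ i) := by
  classical
  induction s using Finset.induction_on with
  | empty => simp [moment_zero]
  | insert i s hi ih => rw [Finset.sum_insert hi, Finset.sum_insert hi, moment_add hF, ih]

theorem moment_fun_add (hF : HasMoments F) (hH : HasMoments H) :
    moment u (fun v => F v + H v) φ = moment u F φ + moment u H φ := by
  rw [moment, moment, moment, ← integral_add (hF u φ) (hH u φ)]
  simp [mul_add]

theorem moment_fun_const_mul (c : ℝ) : moment u (fun v => c * F v) φ = c * moment u F φ := by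
  rw [moment, moment, ← integral_const_mul]
  simp [mul_left_comm]

theorem HasMoments.const_mul (hF : HasMoments F) (c : ℝ) : HasMoments fun v => c * F v :=
  fun u φ => by simpa [mul_left_comm] using (hF u φ).const_mul c

theorem moment_fun_sum {ι : Type*} (s : Finset ι) {F : ι → V3 → ℝ} (hF : ∀ i, HasMoments (F i)) :
    moment u (fun v => ∑ i ∈ s, F i v) φ = ∑ i ∈ s, moment u (F i) φ := by
  simp only [moment, Finset.mul_sum]
  exact integral_finsetSum s fun i _ => hF i u φ

theorem moment_X_mul (i : Fin 3) :
    moment u (fun v => (v i - u i) * F v) φ = moment u F (X i * φ) := by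
  simp only [moment, centred, map_mul, eval_X]
  exact integral_congr_ae (Filter.Eventually.of_forall fun v => by ring)

theorem HasMoments.sub_coord_mul (hF : HasMoments F) (i : Fin 3) (a : ℝ) :
    HasMoments fun v => (v i - a) * F v := fun u φ => by
  convert hF u ((X i + C (u i - a)) * φ) using 2 with v
  simp [centred]
  ring

end moments

/-! ### Weak forms of the collision and transport operators -/

theorem KinO.weight (hΩ : IsOpen Ω) {n : ℕ} {h : ℝ → SpaceTime → V3 → ℝ} (hh : KinO ε₀ Ω n h)
    {u : ℝ → SpaceTime → V3} (hu : ∀ i, MacroO ε₀ Ω n fun ε z => u ε z i)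
    (φ : MvPolynomial (Fin 3) ℝ) :
    KinO ε₀ Ω n (fun ε z v => centred (u ε z) φ v * h ε z v) := by
  induction φ using MvPolynomial.induction_on generalizing h with
  | C a => simpa [centred] using hh.const_mul hΩ a
  | add p q hp hq =>
    exact ((hp hh).add hΩ (hq hh)).congr hΩ fun ε _ z _ v => by simp [centred, add_mul]
  | mul_X p i hp =>
    -- The factor v_i - u_i is moved from the weight onto h; this is why the induction is over all
    -- h.
    refine (hp ((hh.coord_mul hΩ i).add hΩ
      ((hh.macro_mul hΩ (hu i)).const_mul hΩ (-1)))).congr hΩ fun ε _ z _ v => ?_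
    simp [centred]
    ring

theorem macroO_const (c : ℝ) (n : ℕ) : MacroO ε₀ Ω n fun _ _ => c :=
  MacroO.const (fun _ => c) (C := |c|) (fun _ _ => le_rfl) n

theorem KinO.hasMoments (hΩ : IsOpen Ω) {n : ℕ} {h : ℝ → SpaceTime → V3 → ℝ}
    (hh : KinO ε₀ Ω n h) {ε : ℝ} (hε : ε ∈ Ioo 0 ε₀) {z : SpaceTime} (hz : z ∈ Ω) :
    HasMoments (h ε z) := fun u φ =>
  (hh.weight hΩ (u := fun _ _ => u) (fun i => macroO_const (u i) n) φ).integrable hε hz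

theorem KinO.moment (hΩ : IsOpen Ω) {n : ℕ} {h : ℝ → SpaceTime → V3 → ℝ} (hh : KinO ε₀ Ω n h)
    {u : ℝ → SpaceTime → V3} (hu : ∀ i, MacroO ε₀ Ω n fun ε z => u ε z i)
    (φ : MvPolynomial (Fin 3) ℝ) : MacroO ε₀ Ω n (fun ε z => moment (u ε z) (h ε z) φ) :=
  (hh.weight hΩ hu φ).integral hΩ

theorem KinO.moment_dv (hΩ : IsOpen Ω) {n : ℕ} {h : ℝ → SpaceTime → V3 → ℝ}
    (hh : KinO ε₀ Ω (n + 1) h) {ε : ℝ} (hε : ε ∈ Ioo 0 ε₀) {z : SpaceTime} (hz : z ∈ Ω)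
    (u : V3) (φ : MvPolynomial (Fin 3) ℝ) (l : Fin 3) :
    ESFP.moment u (ESFP.dv l (h ε z)) φ = -ESFP.moment u (h ε z) (pderiv l φ) := by
  have h0 := (hh.weight hΩ (u := fun _ _ => u) (fun i => macroO_const (u i) _) φ).integral_dv
    hΩ hε hz l
  have h1 : ∀ v, ESFP.dv l (fun v => centred u φ v * h ε z v) v =
      centred u (pderiv l φ) v * h ε z v + centred u φ v * ESFP.dv l (h ε z) v := fun v => by
    rw [← dv_centred]
    exact fderiv_mul_dir (hasFDerivAt_centred u φ v).differentiableAt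
      (hh.hasFDerivAt_velocity hΩ hε hz v).differentiableAt _
  simp only [h1] at h0
  rw [integral_add (hh.hasMoments hΩ hε hz u _) ((hh.dv hΩ l).hasMoments hΩ hε hz u φ)] at h0
  rw [ESFP.moment, ESFP.moment]
  linarith

/-- Stein's identity: the first-order equation satisfied by a Gaussian, tested against φ and
integrated by parts, lowers the degree of moments. -/
theorem KinO.moment_X_mul_of_dv (hΩ : IsOpen Ω) {n : ℕ} {h : ℝ → SpaceTime → V3 → ℝ}
    (hh : KinO ε₀ Ω (n + 1) h) {ε : ℝ} (hε : ε ∈ Ioo 0 ε₀) {z : SpaceTime} (hz : z ∈ Ω)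
    (u : V3) (φ : MvPolynomial (Fin 3) ℝ) (i : Fin 3) (P : Fin 3 → ℝ)
    (hP : ∀ v, ∑ j, P j * ESFP.dv j (h ε z) v = -((v i - u i) * h ε z v)) :
    ESFP.moment u (h ε z) (X i * φ) = ∑ j, P j * ESFP.moment u (h ε z) (pderiv j φ) := by
  have hm : ∀ j, HasMoments (ESFP.dv j (h ε z)) := fun j => (hh.dv hΩ j).hasMoments hΩ hε hz
  have h1 : ESFP.moment u (fun v => ∑ j, P j * ESFP.dv j (h ε z) v) φ =
      -ESFP.moment u (h ε z) (X i * φ) := by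
    simp only [hP]
    rw [← moment_X_mul, ← neg_one_mul, ← moment_fun_const_mul]
    simp
  rw [moment_fun_sum _ fun j => (hm j).const_mul (P j)] at h1
  simp only [moment_fun_const_mul, hh.moment_dv hΩ hε hz, mul_neg, Finset.sum_neg_distrib] at h1
  exact (neg_inj.1 h1).symm

/-- The divergence is moved onto φ, then the gradient of the diffusive part as well, giving -c·∇φ +
Π:∇²φ under the integral. -/
theorem KinO.moment_collision (hΩ : IsOpen Ω) {n : ℕ} {h : ℝ → SpaceTime → V3 → ℝ}
    (hh : KinO ε₀ Ω (n + 2) h) {ε : ℝ} (hε : ε ∈ Ioo 0 ε₀) {z : SpaceTime} (hz : z ∈ Ω)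
    (R ν τ : ℝ) (φ : MvPolynomial (Fin 3) ℝ) :
    ESFP.moment (velocity (h ε z)) (collision R ν τ (h ε z)) φ = 1 / τ *
      (-∑ i, ESFP.moment (velocity (h ε z)) (h ε z) (X i * pderiv i φ) +
        ∑ i, ∑ j, PiTensor R ν (h ε z) i j *
          ESFP.moment (velocity (h ε z)) (h ε z) (pderiv j (pderiv i φ))) := by
  set u := velocity (h ε z) with hu
  set P := PiTensor R ν (h ε z) with hP
  -- The operator acts in v only, so u and Π may be frozen at their values at (ε, z); no regularity
  -- of them is needed.
  have hJ : ∀ i, KinO ε₀ Ω (n + 1) (fun ε z v => (v i - u i) * h ε z v +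
      ∑ j, P i j * ESFP.dv j (h ε z) v) := fun i => by
    have h1 := ((hh.of_succ.coord_mul hΩ i).add hΩ (hh.of_succ.const_mul hΩ (-u i))).add hΩ
      ((((hh.dv hΩ 0).const_mul hΩ (P i 0)).add hΩ ((hh.dv hΩ 1).const_mul hΩ (P i 1))).add hΩ
        ((hh.dv hΩ 2).const_mul hΩ (P i 2)))
    refine h1.congr hΩ fun ε _ z _ v => ?_
    rw [Fin.sum_univ_three]
    ring
  have hm := hh.hasMoments hΩ hε hz
  have hmd : ∀ j, HasMoments (ESFP.dv j (h ε z)) := fun j => (hh.dv hΩ j).hasMoments hΩ hε hz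
  have key : ∀ i, ESFP.moment u (ESFP.dv i (fun v => (v i - u i) * h ε z v +
      ∑ j, P i j * ESFP.dv j (h ε z) v)) φ = -ESFP.moment u (h ε z) (X i * pderiv i φ) +
      ∑ j, P i j * ESFP.moment u (h ε z) (pderiv j (pderiv i φ)) := fun i => by
    rw [(hJ i).moment_dv hΩ hε hz, moment_fun_add (hm.sub_coord_mul i (u i))
      (fun w ψ => by
        simpa only [Finset.mul_sum] using
          integrable_finsetSum _ fun j _ => ((hmd j).const_mul (P i j)) w ψ),
      moment_fun_sum _ fun j => (hmd j).const_mul (P i j), moment_X_mul]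
    simp only [moment_fun_const_mul, hh.moment_dv hΩ hε hz, mul_neg, Finset.sum_neg_distrib]
    ring
  have : collision R ν τ (h ε z) = fun v => 1 / τ * ∑ i, ESFP.dv i (fun v =>
      (v i - u i) * h ε z v + ∑ j, P i j * ESFP.dv j (h ε z) v) v := rfl
  rw [this, moment_fun_const_mul, moment_fun_sum _ fun i =>
    ((hJ i).dv hΩ i).hasMoments hΩ hε hz, ← Finset.sum_neg_distrib, ← Finset.sum_add_distrib]
  simp only [key]

/-- The free transport operator `∂_t h + v · ∇_x h`. -/
noncomputable def transport (h : SpaceTime → V3 → ℝ) (z : SpaceTime) (v : V3) : ℝ :=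
  dt (fun y => h y v) z + ∑ i, v i * dx i (fun y => h y v) z

theorem KinO.integral_transport (hΩ : IsOpen Ω) {n : ℕ} {h : ℝ → SpaceTime → V3 → ℝ}
    (hh : KinO ε₀ Ω (n + 1) h) {ε : ℝ} (hε : ε ∈ Ioo 0 ε₀) {z : SpaceTime} (hz : z ∈ Ω) :
    ∫ v, transport (h ε) z v = dt (fun y => ∫ v, h ε y v) z +
      ∑ k, dx k (fun y => ∫ v, v k * h ε y v) z := by
  have ht : Integrable fun v => dt (fun y => h ε y v) z :=
    ((hh.dir ((1, 0), 0)).integrable hε hz).congr (Filter.Eventually.of_forall fun v =>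
      (hh.fderiv_left_eq hΩ hε hz v _).symm)
  have hx' : ∀ k v, dx k (fun y => v k * h ε y v) z = v k * dx k (fun y => h ε y v) z :=
    fun k v => by
      have hd := HasFDerivAt.comp z (f := fun y => (y, v))
        (hh.differentiableAt hΩ hε hz v).hasFDerivAt (hasFDerivAt_prodMk_left z v)
      exact DFunLike.congr_fun (fderiv_const_mul hd.differentiableAt (v k)) _
  have hx : ∀ k, Integrable fun v => v k * dx k (fun y => h ε y v) z := fun k =>
    (((hh.coord_mul hΩ k).dir ((0, e k), 0)).integrable hε hz).congr
      (Filter.Eventually.of_forall fun v => by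
        refine Eq.trans ?_ (hx' k v)
        exact ((hh.coord_mul hΩ k).fderiv_left_eq hΩ hε hz v _).symm)
  simp only [transport]
  rw [integral_add ht (integrable_finsetSum _ fun k _ => hx k),
    integral_finsetSum _ fun k _ => hx k]
  congr 1
  · rw [dt, (hh.hasFDerivAt_integral hΩ hε hz).2]
    exact integral_congr_ae (Filter.Eventually.of_forall fun v =>
      hh.fderiv_left_eq hΩ hε hz v _)
  · refine Finset.sum_congr rfl fun k _ => ?_
    rw [dx, ((hh.coord_mul hΩ k).hasFDerivAt_integral hΩ hε hz).2]
    refine integral_congr_ae (Filter.Eventually.of_forall fun v => ?_)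
    simp only [← hx' k v]
    exact (hh.coord_mul hΩ k).fderiv_left_eq hΩ hε hz v _

/-- The acceleration `∂_t u_l + u · ∇u_l`. -/
noncomputable def acceleration (u : SpaceTime → V3) (l : Fin 3) (z : SpaceTime) : ℝ :=
  dt (fun y => u y l) z + ∑ k, u z k * dx k (fun y => u y l) z

/-- The weight φ(v - u(t,x)) does not commute with transport: by the chain rule each derivative also
produces -∂u_l ∂_lφ. Splitting v = u + c sorts these corrections into acceleration and
velocity-gradient terms. -/
theorem KinO.moment_transport (hΩ : IsOpen Ω) {n : ℕ} {h : ℝ → SpaceTime → V3 → ℝ}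
    (hh : KinO ε₀ Ω (n + 1) h) {u : ℝ → SpaceTime → V3}
    (hu : ∀ i, MacroO ε₀ Ω (n + 1) fun ε z => u ε z i)
    {ε : ℝ} (hε : ε ∈ Ioo 0 ε₀) {z : SpaceTime} (hz : z ∈ Ω) (φ : MvPolynomial (Fin 3) ℝ) :
    ESFP.moment (u ε z) (transport (h ε) z) φ =
      dt (fun y => ESFP.moment (u ε y) (h ε y) φ) z +
      ∑ k, dx k (fun y => ESFP.moment (u ε y) (h ε y) (X k * φ) +
        u ε y k * ESFP.moment (u ε y) (h ε y) φ) z +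
      ∑ l, (acceleration (u ε) l z * ESFP.moment (u ε z) (h ε z) (pderiv l φ) +
        ∑ k, dx k (fun y => u ε y l) z * ESFP.moment (u ε z) (h ε z) (X k * pderiv l φ)) := by
  have hW := hh.weight hΩ hu φ
  have hm : ∀ y ∈ Ω, HasMoments (h ε y) := fun y hy => hh.hasMoments hΩ hε hy
  -- the product rule
  have hdir : ∀ v w, fderiv ℝ (fun y => centred (u ε y) φ v * h ε y v) z w =
      centred (u ε z) φ v * fderiv ℝ (fun y => h ε y v) z w -
      ∑ l, fderiv ℝ (fun y => u ε y l) z w * (centred (u ε z) (pderiv l φ) v * h ε z v) := by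
    intro v w
    have hd : HasFDerivAt (fun y => h ε y v) _ z := HasFDerivAt.comp z (f := fun y => (y, v))
      (hh.differentiableAt hΩ hε hz v).hasFDerivAt (hasFDerivAt_prodMk_left z v)
    have hc : HasFDerivAt (fun y => centred (u ε y) φ v) _ z :=
      hasFDerivAt_eval (x := fun i y => v i - u ε y i)
      (fun i => ((hu i).differentiableAt hΩ hε hz).hasFDerivAt.const_sub (v i)) φ
    rw [fderiv_mul_dir hc.differentiableAt hd.differentiableAt, hc.fderiv]
    simp [Fin.sum_univ_three, centred]
    ring
  have hT : ∀ v, centred (u ε z) φ v * transport (h ε) z v =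
      transport (fun y v => centred (u ε y) φ v * h ε y v) z v +
      ∑ l, (acceleration (u ε) l z * (centred (u ε z) (pderiv l φ) v * h ε z v) +
        ∑ k, dx k (fun y => u ε y l) z *
          (centred (u ε z) (X k * pderiv l φ) v * h ε z v)) := by
    intro v
    simp only [transport, acceleration, dt, dx, hdir, Fin.sum_univ_three]
    simp only [centred, map_mul, eval_X]
    ring
  have hTi : Integrable fun v => transport (fun y v => centred (u ε y) φ v * h ε y v) z v := by
    have h0 := (hW.dir ((1, 0), 0)).integrable hε hz
    have hk := fun k => ((hW.dir ((0, e k), 0)).coord_mul hΩ k).integrable hε hz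
    refine (h0.add (integrable_finsetSum Finset.univ fun k _ => hk k)).congr
      (Filter.Eventually.of_forall fun v => ?_)
    simp only [transport, dt, dx, hW.fderiv_left_eq hΩ hε hz]
    simp
  have hmul : ∀ k, ∀ y ∈ Ω, ∫ v, v k * (centred (u ε y) φ v * h ε y v) =
      ESFP.moment (u ε y) (h ε y) (X k * φ) + u ε y k * ESFP.moment (u ε y) (h ε y) φ := by
    intro k y hy
    rw [← moment_C_mul, ← moment_add (hm y hy), ESFP.moment]
    refine integral_congr_ae (Filter.Eventually.of_forall fun v => ?_)
    simp [centred]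
    ring
  rw [ESFP.moment]
  simp only [hT]
  have hI : ∀ l, Integrable fun v => acceleration (u ε) l z *
      (centred (u ε z) (pderiv l φ) v * h ε z v) + ∑ k, dx k (fun y => u ε y l) z *
          (centred (u ε z) (X k * pderiv l φ) v * h ε z v) := fun l =>
    ((hm z hz _ _).const_mul _).add
      (integrable_finsetSum _ fun k _ => (hm z hz _ _).const_mul _)
  rw [integral_add hTi (integrable_finsetSum _ fun l _ => hI l),
    integral_finsetSum _ fun l _ => hI l, hW.integral_transport hΩ hε hz]
  congr 1
  · congr 1
    refine Finset.sum_congr rfl fun k _ => ?_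
    rw [dx, dx, fderiv_congr_of_isOpen hΩ (hmul k) hz]
  · refine Finset.sum_congr rfl fun l _ => ?_
    rw [integral_add ((hm z hz _ _).const_mul _)
      (integrable_finsetSum _ fun k _ => (hm z hz _ _).const_mul _), integral_const_mul,
      integral_finsetSum _ fun k _ => (hm z hz _ _).const_mul _]
    simp only [integral_const_mul, ESFP.moment]

/-! ### Moments of low degree -/

/-- The polynomial `|X|²`. -/
noncomputable def normSqPoly : MvPolynomial (Fin 3) ℝ := ∑ k, X k * X k

theorem pderiv_X_eq (l i : Fin 3) :
    pderiv l (X i : MvPolynomial (Fin 3) ℝ) = C (if i = l then 1 else 0) := by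
  rw [pderiv_X, Pi.single_apply]
  split_ifs <;> simp

theorem pderiv_X_mul (l i : Fin 3) (φ : MvPolynomial (Fin 3) ℝ) :
    pderiv l (X i * φ) = C (if i = l then 1 else 0) * φ + X i * pderiv l φ := by
  rw [Derivation.leibniz, pderiv_X_eq, smul_eq_mul, smul_eq_mul]
  ring

theorem pderiv_X_mul_X (l i j : Fin 3) : pderiv l (X i * X j : MvPolynomial (Fin 3) ℝ) =
    C (if i = l then 1 else 0) * X j + C (if j = l then 1 else 0) * X i := by
  rw [pderiv_X_mul, pderiv_X_eq, mul_comm (X i)]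

theorem pderiv_normSqPoly (l : Fin 3) : pderiv l normSqPoly = C 2 * X l := by
  rw [normSqPoly, map_sum]
  simp only [pderiv_X_mul_X, ← two_mul]
  rw [Finset.sum_eq_single l (fun b _ hb => by simp [hb]) (by simp)]
  simp [map_ofNat]

theorem pderiv_X_mul_normSqPoly (l i : Fin 3) : pderiv l (X i * normSqPoly) =
    C (if i = l then 1 else 0) * normSqPoly + C 2 * (X i * X l) := by
  rw [pderiv_X_mul, pderiv_normSqPoly]
  ring

theorem centred_normSqPoly (u v : V3) : centred u normSqPoly v = ‖v - u‖ ^ 2 := by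
  rw [EuclideanSpace.real_norm_sq_eq]
  simp [centred, normSqPoly, pow_two]

section lowdegree

variable {F : V3 → ℝ}

theorem moment_one (u : V3) : moment u F 1 = density F := by simp [moment, centred, density]

theorem moment_X (hF : HasMoments F) (hρ : density F ≠ 0) (i : Fin 3) :
    moment (velocity F) F (X i) = 0 := by
  have h1 : moment (velocity F) F (X i + C (velocity F i) * 1) = ∫ v, v i * F v := by
    rw [moment]
    exact integral_congr_ae (Filter.Eventually.of_forall fun v => by simp [centred])
  rw [moment_add hF, moment_C_mul, moment_one] at h1
  have h2 : velocity F i * density F = ∫ v, v i * F v := by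
    simp only [velocity]
    field_simp
  linarith

theorem moment_X_mul_X (i j : Fin 3) : moment (velocity F) F (X i * X j) = stress F i j := by
  simp [moment, centred, stress]

theorem moment_X_mul_normSqPoly (i : Fin 3) :
    moment (velocity F) F (X i * normSqPoly) = 2 * heatFlux F i := by
  rw [moment, heatFlux, ← integral_const_mul]
  refine integral_congr_ae (Filter.Eventually.of_forall fun v => ?_)
  have h := centred_normSqPoly (velocity F) v
  simp only [centred] at h
  simp only [centred, map_mul, eval_X, h]
  ring

theorem stress_comm (i j : Fin 3) : stress F i j = stress F j i := by
  rw [← moment_X_mul_X, ← moment_X_mul_X, mul_comm]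

theorem moment_normSqPoly (hF : HasMoments F) :
    moment (velocity F) F normSqPoly = ∑ k, stress F k k := by
  rw [normSqPoly, moment_sum hF]
  simp only [moment_X_mul_X]

/-- König's decomposition: in ½|v|² = ½|c|² + u·c + ½|u|² the cross term has zero mean. -/
theorem energy_eq (hF : HasMoments F) (hρ : density F ≠ 0) :
    energy F = 1 / 2 * density F * ‖velocity F‖ ^ 2 + 1 / 2 * ∑ k, stress F k k := by
  set u := velocity F with hu
  have h1 : energy F = moment u F (C (1 / 2) * normSqPoly + ∑ k, C (u k) * X k +
      C (1 / 2 * ‖u‖ ^ 2) * 1) := by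
    rw [energy, moment]
    refine integral_congr_ae (Filter.Eventually.of_forall fun v => ?_)
    simp only [centred, normSqPoly, EuclideanSpace.real_norm_sq_eq, Fin.sum_univ_three, map_add,
      map_mul, eval_C, eval_X, map_one]
    ring
  rw [h1, moment_add hF, moment_add hF, moment_sum hF]
  simp only [moment_C_mul, hu, moment_X hF hρ, moment_one, moment_normSqPoly hF]
  simp
  ring

theorem sum_stress (hF : HasMoments F) (hρ : density F ≠ 0) {R : ℝ} (hR : R ≠ 0) :
    ∑ k, stress F k k = 3 * pressure R F := by
  have h := energy_eq hF hρ
  rw [pressure, temperature]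
  field_simp
  linarith

theorem PiTensor_apply (R ν : ℝ) (i j : Fin 3) : PiTensor R ν F i j =
    (1 - ν) * (R * temperature R F) * (if i = j then 1 else 0) +
      ν * ((density F)⁻¹ * stress F i j) := by
  simp [PiTensor, Theta, Matrix.one_apply]

theorem density_mul_PiTensor (hρ : density F ≠ 0) (R ν : ℝ) (i j : Fin 3) :
    density F * PiTensor R ν F i j =
      (1 - ν) * pressure R F * (if i = j then 1 else 0) + ν * stress F i j := by
  rw [PiTensor_apply, pressure]
  field_simp

/-- The trace of ρΠ is 3(1-ν)p + 3νp = 3p whatever ν is, and it is a sum of positive diagonal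
entries. -/
theorem pressure_pos (hF : HasMoments F) (hρ : 0 < density F) {R ν : ℝ} (hR : R ≠ 0)
    (hP : (PiTensor R ν F).PosDef) : 0 < pressure R F := by
  have h1 : ∀ i, 0 < density F * PiTensor R ν F i i := fun i => mul_pos hρ hP.diag_pos
  simp only [density_mul_PiTensor hρ.ne'] at h1
  have h2 := sum_stress hF hρ.ne' hR
  rw [Fin.sum_univ_three] at h2
  have h3 := h1 0
  have h4 := h1 1
  have h5 := h1 2
  simp only [if_true, mul_one] at h3 h4 h5
  have h6 := congrArg (ν * ·) h2
  linarith

end lowdegree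

/-- The gradient of G is -Π⁻¹(v-u)G, and Π cancels its inverse. The normalising prefactor plays no
role. -/
theorem sum_PiTensor_mul_dv_gaussian {R ν : ℝ} {F : V3 → ℝ} (hP : (PiTensor R ν F).PosDef)
    (i : Fin 3) (v : V3) : ∑ j, PiTensor R ν F i j * dv j (gaussian R ν F) v =
      -((v i - velocity F i) * gaussian R ν F v) := by
  set P := PiTensor R ν F with hPdef
  set u := velocity F with hu
  have hinv : P * P⁻¹ = 1 := Matrix.mul_nonsing_inv P (P.isUnit_iff_isUnit_det.1 hP.isUnit)
  have hsym : ∀ a b, P⁻¹ a b = P⁻¹ b a := fun a b => by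
    simpa using (hP.isHermitian.inv.apply b a)
  set S : MvPolynomial (Fin 3) ℝ := ∑ a, ∑ b, C (P⁻¹ a b) * (X a * X b) with hS
  set c := density F / Real.sqrt (((2 * Real.pi) • P).det)
  have hg : gaussian R ν F = fun v => c * Real.exp (-(centred u S v) / 2) := by
    funext v
    simp only [gaussian, ← hPdef, ← hu]
    congr 4
    simp only [hS, centred, map_sum, map_mul, eval_C, eval_X]
    exact Finset.sum_congr rfl fun a _ => Finset.sum_congr rfl fun b _ => by ring
  have hdS : ∀ j, centred u (pderiv j S) v = 2 * ∑ b, P⁻¹ j b * (v b - u b) := by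
    intro j
    have h1 : centred u (pderiv j S) v =
        (∑ b, P⁻¹ j b * (v b - u b)) + ∑ a, P⁻¹ a j * (v a - u a) := by
      simp only [hS, map_sum, pderiv_C_mul, pderiv_X_mul_X, centred, map_mul, eval_C,
        eval_X, map_add]
      simp [mul_add, Finset.sum_add_distrib]
    rw [h1, two_mul]
    congr 1
    exact Finset.sum_congr rfl fun a _ => by rw [hsym]
  have hdv : ∀ j, dv j (gaussian R ν F) v =
      -(∑ b, P⁻¹ j b * (v b - u b)) * gaussian R ν F v := by
    intro j
    have hd : HasFDerivAt (fun v => c * Real.exp (-(centred u S v) / 2)) _ v :=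
      (((hasFDerivAt_centred u S v).neg.mul_const (2⁻¹ : ℝ)).exp.const_mul c)
    have h1 := dv_centred u S j v
    rw [dv, (hasFDerivAt_centred u S v).fderiv] at h1
    rw [hg, dv, hd.fderiv]
    set L := ∑ i, centred u (pderiv i S) v • (EuclideanSpace.proj i : V3 →L[ℝ] ℝ) with hL
    simp only [smul_apply, neg_apply, Pi.neg_apply, h1, hdS,
      smul_eq_mul]
    rw [div_eq_mul_inv]
    ring
  have hc : v i - u i = ∑ j, ∑ b, P i j * (P⁻¹ j b * (v b - u b)) := by
    rw [Finset.sum_comm]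
    simp only [← mul_assoc, ← Finset.sum_mul]
    have : ∀ b, ∑ j, P i j * P⁻¹ j b = if i = b then 1 else 0 := fun b => by
      rw [← Matrix.mul_apply, hinv, Matrix.one_apply]
    simp [this]
  simp only [hdv]
  rw [hc, Finset.sum_mul, ← Finset.sum_neg_distrib]
  refine Finset.sum_congr rfl fun j _ => ?_
  rw [← Finset.mul_sum]
  ring

/-! ### Regularity of the macroscopic fields -/

section fields

variable {f : ℝ → SpaceTime → V3 → ℝ}

theorem KinO.density (hΩ : IsOpen Ω) (hf : KinO ε₀ Ω 2 f) :
    MacroO ε₀ Ω 2 fun ε z => density (f ε z) := hf.integral hΩ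

/-- The densities are locally bounded below, uniformly in `ε`. -/
def NoVacuum (ε₀ : ℝ) (Ω : Set SpaceTime) (f : ℝ → SpaceTime → V3 → ℝ) : Prop :=
  ∀ K ⊆ Ω, IsCompact K → ∃ c > 0, ∀ ε ∈ Ioo 0 ε₀, ∀ z ∈ K, c ≤ ESFP.density (f ε z)

theorem NoVacuum.pos (hρ : NoVacuum ε₀ Ω f) {ε : ℝ} (hε : ε ∈ Ioo 0 ε₀) {z : SpaceTime}
    (hz : z ∈ Ω) : 0 < density (f ε z) :=
  pos_of_locally_bounded_below (a := fun ε z => density (f ε z)) hρ hε hz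

theorem KinO.velocity (hΩ : IsOpen Ω) (hf : KinO ε₀ Ω 2 f) (hρ : NoVacuum ε₀ Ω f) (i : Fin 3) :
    MacroO ε₀ Ω 2 fun ε z => velocity (f ε z) i :=
  (((hf.coord_mul hΩ i).integral hΩ).mul hΩ ((hf.density hΩ).inv hΩ hρ)).congr hΩ
    fun _ _ _ _ => by simp [ESFP.velocity, div_eq_mul_inv]

theorem KinO.central_moment (hΩ : IsOpen Ω) (hf : KinO ε₀ Ω 2 f) (hρ : NoVacuum ε₀ Ω f)
    (φ : MvPolynomial (Fin 3) ℝ) :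
    MacroO ε₀ Ω 2 fun ε z => ESFP.moment (ESFP.velocity (f ε z)) (f ε z) φ :=
  hf.moment hΩ (hf.velocity hΩ hρ) φ

theorem KinO.stress (hΩ : IsOpen Ω) (hf : KinO ε₀ Ω 2 f) (hρ : NoVacuum ε₀ Ω f) (i j : Fin 3) :
    MacroO ε₀ Ω 2 fun ε z => stress (f ε z) i j :=
  (hf.central_moment hΩ hρ (X i * X j)).congr hΩ fun _ _ _ _ => (moment_X_mul_X i j).symm

theorem KinO.pressure (hΩ : IsOpen Ω) (hf : KinO ε₀ Ω 2 f) (hρ : NoVacuum ε₀ Ω f) {R : ℝ}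
    (hR : R ≠ 0) : MacroO ε₀ Ω 2 fun ε z => pressure R (f ε z) := by
  refine ((MacroO.sum hΩ Finset.univ fun k => hf.stress hΩ hρ k k).const_mul hΩ (1 / 3)).congr hΩ
    fun ε hε z hz => ?_
  rw [sum_stress (hf.hasMoments hΩ hε hz) (hρ.pos hε hz).ne' hR]
  ring

theorem KinO.temperature (hΩ : IsOpen Ω) (hf : KinO ε₀ Ω 2 f) (hρ : NoVacuum ε₀ Ω f) {R : ℝ}
    (hR : R ≠ 0) : MacroO ε₀ Ω 2 fun ε z => temperature R (f ε z) := by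
  refine (((hf.pressure hΩ hρ hR).mul hΩ ((hf.density hΩ).inv hΩ hρ)).const_mul hΩ R⁻¹).congr hΩ
    fun ε hε z hz => ?_
  have := (hρ.pos hε hz).ne'
  rw [ESFP.pressure]
  field_simp

theorem KinO.PiTensor (hΩ : IsOpen Ω) (hf : KinO ε₀ Ω 2 f) (hρ : NoVacuum ε₀ Ω f) {R : ℝ}
    (hR : R ≠ 0) (ν : ℝ) (i j : Fin 3) : MacroO ε₀ Ω 2 fun ε z => PiTensor R ν (f ε z) i j := by
  refine ((hf.temperature hΩ hρ hR).const_mul hΩ ((1 - ν) * R * if i = j then 1 else 0)).add hΩ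
    ((((hf.density hΩ).inv hΩ hρ).mul hΩ (hf.stress hΩ hρ i j)).const_mul hΩ ν) |>.congr hΩ
    fun ε hε z hz => ?_
  rw [PiTensor_apply]
  ring

end fields

/-! ### Distributions close to their anisotropic Gaussian -/

/-- `f` is a rapidly decaying family without vacuum of the form `G(f) + ε h`, with `h = O(1)`. -/
structure NearGaussian (R ν ε₀ : ℝ) (Ω : Set SpaceTime) (f h : ℝ → SpaceTime → V3 → ℝ) :
    Prop where
  isOpen : IsOpen Ω
  R_ne_zero : R ≠ 0
  ν_lt_one : ν < 1
  kinO : KinO ε₀ Ω 2 f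
  kinO_dev : KinO ε₀ Ω 2 h
  noVacuum : NoVacuum ε₀ Ω f
  posDef : ∀ ε ∈ Ioo 0 ε₀, ∀ z ∈ Ω, (PiTensor R ν (f ε z)).PosDef
  eq_add : ∀ ε ∈ Ioo 0 ε₀, ∀ z ∈ Ω, ∀ v, f ε z v = gaussian R ν (f ε z) v + ε * h ε z v

namespace NearGaussian

variable {R ν : ℝ} {f h : ℝ → SpaceTime → V3 → ℝ} (H : NearGaussian R ν ε₀ Ω f h)
include H

theorem hasMoments {ε : ℝ} (hε : ε ∈ Ioo 0 ε₀) {z : SpaceTime} (hz : z ∈ Ω) :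
    HasMoments (f ε z) := H.kinO.hasMoments H.isOpen hε hz

/-- Regularity and decay of G come from G = f - εh, without uniform estimates on Π⁻¹ or its
determinant. -/
theorem kinO_gaussian : KinO ε₀ Ω 2 fun ε z => gaussian R ν (f ε z) :=
  (H.kinO.add H.isOpen ((H.kinO_dev.macro_mul H.isOpen (macroO_eps 2)).const_mul H.isOpen
    (-1))).congr H.isOpen fun ε hε z hz v => by
      linarith [H.eq_add ε hε z hz v]

theorem moment_eq {ε : ℝ} (hε : ε ∈ Ioo 0 ε₀) {z : SpaceTime} (hz : z ∈ Ω) (u : V3)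
    (φ : MvPolynomial (Fin 3) ℝ) : moment u (f ε z) φ =
      moment u (gaussian R ν (f ε z)) φ + ε * moment u (h ε z) φ := by
  rw [← moment_fun_const_mul, ← moment_fun_add (H.kinO_gaussian.hasMoments H.isOpen hε hz)
    ((H.kinO_dev.hasMoments H.isOpen hε hz).const_mul ε)]
  simp only [← H.eq_add ε hε z hz]

theorem gaussian_X_mul {ε : ℝ} (hε : ε ∈ Ioo 0 ε₀) {z : SpaceTime} (hz : z ∈ Ω)
    (φ : MvPolynomial (Fin 3) ℝ) (i : Fin 3) :
    moment (velocity (f ε z)) (gaussian R ν (f ε z)) (X i * φ) =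
      ∑ j, PiTensor R ν (f ε z) i j *
        moment (velocity (f ε z)) (gaussian R ν (f ε z)) (pderiv j φ) :=
  H.kinO_gaussian.moment_X_mul_of_dv H.isOpen hε hz _ φ i _
    (sum_PiTensor_mul_dv_gaussian (H.posDef ε hε z hz) i)

/-- The mass of G is also read off from f = G + εh, so the Gaussian integral is never computed; the
discrepancy with ρ is absorbed in the O(ε) errors. -/
theorem gaussian_one {ε : ℝ} (hε : ε ∈ Ioo 0 ε₀) {z : SpaceTime} (hz : z ∈ Ω) :
    moment (velocity (f ε z)) (gaussian R ν (f ε z)) 1 =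
      density (f ε z) - ε * moment (velocity (f ε z)) (h ε z) 1 := by
  rw [← moment_one (velocity (f ε z)), H.moment_eq hε hz]
  ring

theorem gaussian_X {ε : ℝ} (hε : ε ∈ Ioo 0 ε₀) {z : SpaceTime} (hz : z ∈ Ω) (i : Fin 3) :
    moment (velocity (f ε z)) (gaussian R ν (f ε z)) (X i) = 0 := by
  have := H.gaussian_X_mul hε hz 1 i
  simpa [moment_zero] using this

theorem gaussian_X_mul_X {ε : ℝ} (hε : ε ∈ Ioo 0 ε₀) {z : SpaceTime} (hz : z ∈ Ω) (i j : Fin 3) :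
    moment (velocity (f ε z)) (gaussian R ν (f ε z)) (X i * X j) =
      PiTensor R ν (f ε z) i j *
        moment (velocity (f ε z)) (gaussian R ν (f ε z)) 1 := by
  rw [H.gaussian_X_mul hε hz]
  simp only [pderiv_X_eq, moment_C]
  simp

theorem gaussian_X_mul_X_mul_X {ε : ℝ} (hε : ε ∈ Ioo 0 ε₀) {z : SpaceTime} (hz : z ∈ Ω)
    (i j k : Fin 3) :
    moment (velocity (f ε z)) (gaussian R ν (f ε z)) (X i * (X j * X k)) = 0 := by
  rw [H.gaussian_X_mul hε hz]
  simp only [pderiv_X_mul_X, moment_add (H.kinO_gaussian.hasMoments H.isOpen hε hz),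
    moment_C_mul, H.gaussian_X hε hz]
  simp

/-- Isserlis' formula for fourth moments with one pair of indices contracted, obtained by applying
Stein's identity twice. -/
theorem gaussian_X_mul_X_mul_normSqPoly {ε : ℝ} (hε : ε ∈ Ioo 0 ε₀) {z : SpaceTime} (hz : z ∈ Ω)
    (i j : Fin 3) :
    moment (velocity (f ε z)) (gaussian R ν (f ε z)) (X i * (X j * normSqPoly)) =
      (PiTensor R ν (f ε z) i j * ∑ k, PiTensor R ν (f ε z) k k +
        2 * ∑ k, PiTensor R ν (f ε z) i k * PiTensor R ν (f ε z) j k) *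
        moment (velocity (f ε z)) (gaussian R ν (f ε z)) 1 := by
  have hm := H.kinO_gaussian.hasMoments H.isOpen hε hz
  have hn : moment (velocity (f ε z)) (gaussian R ν (f ε z)) normSqPoly =
      (∑ k, PiTensor R ν (f ε z) k k) *
        moment (velocity (f ε z)) (gaussian R ν (f ε z)) 1 := by
    rw [normSqPoly, moment_sum hm, Finset.sum_mul]
    simp only [H.gaussian_X_mul_X hε hz]
  rw [H.gaussian_X_mul hε hz]
  simp only [pderiv_X_mul_normSqPoly, moment_add hm, moment_C_mul, H.gaussian_X_mul_X hε hz, hn]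
  simp only [mul_add, Finset.sum_add_distrib, add_mul, Finset.mul_sum, Finset.sum_mul]
  congr 1
  · simp [mul_assoc]
  · exact Finset.sum_congr rfl fun k _ => by ring

theorem moment_dev (φ : MvPolynomial (Fin 3) ℝ) :
    MacroO ε₀ Ω 2 fun ε z => moment (velocity (f ε z)) (h ε z) φ :=
  H.kinO_dev.moment H.isOpen (H.kinO.velocity H.isOpen H.noVacuum) φ

theorem density_ne_zero {ε : ℝ} (hε : ε ∈ Ioo 0 ε₀) {z : SpaceTime} (hz : z ∈ Ω) :
    density (f ε z) ≠ 0 := (H.noVacuum.pos hε hz).ne'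

/-- Second moments of f are Π⟨G⟩ + O(ε) = Π ρ + O(ε), and ρΠ = (1-ν)pI + νΣ contains Σ again.
Collecting terms gives (1-ν)(Σ - pI) = O(ε), and 1-ν is nonzero. -/
theorem orderO_stress (i j : Fin 3) : OrderO ε₀ Ω 1 2 fun ε z =>
    stress (f ε z) i j - pressure R (f ε z) * (if i = j then 1 else 0) := by
  have h1 := (((H.moment_dev (X i * X j)).add H.isOpen
    (((H.kinO.PiTensor H.isOpen H.noVacuum H.R_ne_zero ν i j).mul H.isOpen
      (H.moment_dev 1)).const_mul H.isOpen (-1))).const_mul H.isOpen (1 - ν)⁻¹)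
  refine (h1.orderO.eps_mul H.isOpen).congr H.isOpen fun ε hε z hz => ?_
  have h2 := H.moment_eq hε hz (velocity (f ε z)) (X i * X j)
  rw [H.gaussian_X_mul_X hε hz, H.gaussian_one hε hz, moment_X_mul_X, mul_sub, mul_comm _
    (density _), density_mul_PiTensor (H.density_ne_zero hε hz)] at h2
  have h3 : 1 - ν ≠ 0 := by linarith [H.ν_lt_one]
  field_simp
  linarith

theorem orderO_third (i j k : Fin 3) : OrderO ε₀ Ω 1 2 fun ε z =>
    moment (velocity (f ε z)) (f ε z) (X i * (X j * X k)) := by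
  refine ((H.moment_dev (X i * (X j * X k))).orderO.eps_mul H.isOpen).congr H.isOpen
    fun ε hε z hz => ?_
  rw [H.moment_eq hε hz, H.gaussian_X_mul_X_mul_X hε hz, zero_add]

theorem orderO_heatFlux (i : Fin 3) : OrderO ε₀ Ω 1 2 fun ε z => heatFlux (f ε z) i := by
  refine ((OrderO.sum H.isOpen Finset.univ fun k => H.orderO_third i k k).const_mul H.isOpen
    (1 / 2)).congr H.isOpen fun ε hε z hz => ?_
  have h1 := moment_X_mul_normSqPoly (F := f ε z) i
  rw [normSqPoly, Finset.mul_sum, moment_sum (H.hasMoments hε hz)] at h1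
  rw [h1]
  ring

theorem orderO_PiTensor (i j : Fin 3) : OrderO ε₀ Ω 1 2 fun ε z =>
    PiTensor R ν (f ε z) i j - R * temperature R (f ε z) * (if i = j then 1 else 0) := by
  refine (((H.orderO_stress i j).mul_macroO H.isOpen
    ((H.kinO.density H.isOpen).inv H.isOpen H.noVacuum)).const_mul H.isOpen ν).congr H.isOpen
      fun ε hε z hz => ?_
  have := H.density_ne_zero hε hz
  rw [PiTensor_apply, pressure]
  field_simp
  ring

/-- With Π replaced by θI, θ = RT, Isserlis' formula gives θ·3θ + 2θ² = 5θ² on the diagonal; times ρ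
this is 5pθ. -/
theorem orderO_fourth (i j : Fin 3) : OrderO ε₀ Ω 1 2 fun ε z =>
    moment (velocity (f ε z)) (f ε z) (X i * (X j * normSqPoly)) -
      5 * (pressure R (f ε z) * (R * temperature R (f ε z))) * (if i = j then 1 else 0) := by
  have hΩ := H.isOpen
  have hρ := H.kinO.density hΩ
  have hθ := (H.kinO.temperature hΩ H.noVacuum H.R_ne_zero).const_mul hΩ R
  have hP := H.kinO.PiTensor hΩ H.noVacuum H.R_ne_zero ν
  have hd := H.orderO_PiTensor
  -- the error made by replacing the tensor by its isotropic part
  have h1 : OrderO ε₀ Ω 1 2 fun ε z =>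
      (PiTensor R ν (f ε z) i j * ∑ k, PiTensor R ν (f ε z) k k +
        2 * ∑ k, PiTensor R ν (f ε z) i k * PiTensor R ν (f ε z) j k) -
      5 * (R * temperature R (f ε z)) ^ 2 * (if i = j then 1 else 0) := by
    -- Telescoping: each product of two entries of Π minus its isotropic value is written as a sum
    -- of terms containing a factor Π - θI.
    have h2 := (hd i j).mul_macroO hΩ (MacroO.sum hΩ Finset.univ fun k => hP k k)
    have h3 := ((OrderO.sum hΩ Finset.univ fun k => hd k k).mul_macroO hΩ hθ).const_mul hΩ
      (if i = j then 1 else 0)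
    have h4 := OrderO.sum hΩ Finset.univ fun k => (hd i k).mul_macroO hΩ (hP j k)
    have h5 := (hd j i).mul_macroO hΩ hθ
    refine ((h2.add hΩ h3).add hΩ ((h4.add hΩ h5).const_mul hΩ 2)).congr hΩ fun ε hε z hz => ?_
    simp only [sub_mul, Finset.sum_sub_distrib, mul_ite, ite_mul, mul_zero, zero_mul, mul_one,
      Finset.sum_ite_eq, Finset.mem_univ, if_true, Finset.sum_const, Finset.card_univ,
      Fintype.card_fin, nsmul_eq_mul, eq_comm (a := j)]
    split_ifs with hij
    · push_cast
      ring
    · ring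
  have h6 := (H.moment_dev (X i * (X j * normSqPoly))).orderO.eps_mul hΩ
  -- This is the error made by replacing ⟨G⟩ by ρ.
  have h7 := ((((MacroO.mul hΩ (hP i j) (MacroO.sum hΩ Finset.univ fun k => hP k k)).add hΩ
    ((MacroO.sum hΩ Finset.univ fun k => (hP i k).mul hΩ (hP j k)).const_mul hΩ 2)).mul hΩ
      (H.moment_dev 1)).orderO.eps_mul hΩ)
  refine (((h1.mul_macroO hΩ hρ).add hΩ h6).sub hΩ h7).congr hΩ fun ε hε z hz => ?_
  rw [H.moment_eq hε hz, H.gaussian_X_mul_X_mul_normSqPoly hε hz, H.gaussian_one hε hz, pressure]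
  ring

end NearGaussian

theorem fderiv_add_dir {E : Type*} [NormedAddCommGroup E] [NormedSpace ℝ E] {a b : E → ℝ} {z : E}
    (ha : DifferentiableAt ℝ a z) (hb : DifferentiableAt ℝ b z) (w : E) :
    fderiv ℝ (fun y => a y + b y) z w = fderiv ℝ a z w + fderiv ℝ b z w := by
  rw [fderiv_fun_add ha hb]
  rfl

theorem fderiv_sub_dir {E : Type*} [NormedAddCommGroup E] [NormedSpace ℝ E] {a b : E → ℝ} {z : E}
    (ha : DifferentiableAt ℝ a z) (hb : DifferentiableAt ℝ b z) (w : E) :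
    fderiv ℝ (fun y => a y - b y) z w = fderiv ℝ a z w - fderiv ℝ b z w := by
  rw [fderiv_fun_sub ha hb]
  rfl

theorem fderiv_const_dir {E : Type*} [NormedAddCommGroup E] [NormedSpace ℝ E] (c : ℝ) (z w : E) :
    fderiv ℝ (fun _ : E => c) z w = 0 := by simp

/-- Conservation of total energy follows from the balances of mass, momentum and internal energy. -/
theorem total_energy_balance {ρ p : SpaceTime → ℝ} {u q : Fin 3 → SpaceTime → ℝ}
    {s : Fin 3 → Fin 3 → SpaceTime → ℝ} {z : SpaceTime} (hρ : DifferentiableAt ℝ ρ z)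
    (hp : DifferentiableAt ℝ p z) (hu : ∀ i, DifferentiableAt ℝ (u i) z)
    (hs : ∀ i j, DifferentiableAt ℝ (s i j) z)
    (mass : dt ρ z + ∑ k, dx k (fun y => ρ y * u k y) z = 0)
    (momentum : ∀ i, ρ z * (dt (u i) z + ∑ k, u k z * dx k (u i) z) + ∑ k, dx k (s k i) z = 0)
    (internal : 3 / 2 * (dt p z + ∑ k, dx k (fun y => p y * u k y) z) + ∑ k, dx k (q k) z +
      ∑ l, ∑ k, dx k (u l) z * s k l z = 0) :
    dt (fun y => 1 / 2 * (ρ y * ∑ l, u l y * u l y) + 3 / 2 * p y) z +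
      ∑ k, dx k (fun y => (1 / 2 * (ρ y * ∑ l, u l y * u l y) + 3 / 2 * p y) * u k y) z +
      ∑ k, dx k (q k) z + ∑ k, dx k (fun y => ∑ l, s k l y * u l y) z = 0 := by
  have m0 := momentum 0
  have m1 := momentum 1
  have m2 := momentum 2
  simp only [Fin.sum_univ_three, dt, dx] at *
  simp (disch := fun_prop) only [fderiv_mul_dir, fderiv_add_dir, fderiv_const_dir] at *
  -- The kinetic energy balance is u·(momentum) + ½|u|²(mass).
  linear_combination internal + u 0 z * m0 + u 1 z * m1 + u 2 z * m2 +
    1 / 2 * (u 0 z ^ 2 + u 1 z ^ 2 + u 2 z ^ 2) * mass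

/-! ### Kinetic solutions -/

/-- A solution of the ES-Fokker-Planck model close to its anisotropic Gaussian. -/
structure KineticSolution (R ν ε₀ : ℝ) (Ω : Set SpaceTime) (τ : ℝ → SpaceTime → ℝ)
    (f h : ℝ → SpaceTime → V3 → ℝ) : Prop extends NearGaussian R ν ε₀ Ω f h where
  τ_pos : ∀ ε ∈ Ioo 0 ε₀, ∀ z ∈ Ω, 0 < τ ε z
  macroO_τ : MacroO ε₀ Ω 1 τ
  solution : ∀ ε ∈ Ioo 0 ε₀, IsSolution R ν ε (τ ε) Ω (f ε)

namespace KineticSolution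

variable {R ν : ℝ} {τ : ℝ → SpaceTime → ℝ} {f h : ℝ → SpaceTime → V3 → ℝ}
  (H : KineticSolution R ν ε₀ Ω τ f h)
include H

theorem velocity (i : Fin 3) : MacroO ε₀ Ω 2 fun ε z => velocity (f ε z) i :=
  H.kinO.velocity H.isOpen H.noVacuum i

theorem pressure : MacroO ε₀ Ω 2 fun ε z => pressure R (f ε z) :=
  H.kinO.pressure H.isOpen H.noVacuum H.R_ne_zero

theorem moment_X {ε : ℝ} (hε : ε ∈ Ioo 0 ε₀) {z : SpaceTime} (hz : z ∈ Ω) (i : Fin 3) :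
    moment (ESFP.velocity (f ε z)) (f ε z) (X i) = 0 :=
  ESFP.moment_X (H.hasMoments hε hz) (H.density_ne_zero hε hz) i

/-- The exact moment equation for an arbitrary centred polynomial, from which all balances below are
read off. A and B are convenient expressions for the density and flux; agreement on the open set Ω
is enough to differentiate them. -/
theorem balance {ε : ℝ} (hε : ε ∈ Ioo 0 ε₀) {z : SpaceTime} (hz : z ∈ Ω)
    (φ : MvPolynomial (Fin 3) ℝ) {A : SpaceTime → ℝ} {B : Fin 3 → SpaceTime → ℝ}
    (hA : ∀ y ∈ Ω, A y = moment (ESFP.velocity (f ε y)) (f ε y) φ)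
    (hB : ∀ k, ∀ y ∈ Ω, B k y = moment (ESFP.velocity (f ε y)) (f ε y) (X k * φ) +
      ESFP.velocity (f ε y) k * moment (ESFP.velocity (f ε y)) (f ε y) φ) :
    dt A z + ∑ k, dx k (B k) z +
      ∑ l, (acceleration (fun y => ESFP.velocity (f ε y)) l z *
          moment (ESFP.velocity (f ε z)) (f ε z) (pderiv l φ) +
        ∑ k, dx k (fun y => ESFP.velocity (f ε y) l) z *
          moment (ESFP.velocity (f ε z)) (f ε z) (X k * pderiv l φ)) =
      1 / (ε * τ ε z) *
        (-∑ i, moment (ESFP.velocity (f ε z)) (f ε z) (X i * pderiv i φ) +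
          ∑ i, ∑ j, PiTensor R ν (f ε z) i j *
            moment (ESFP.velocity (f ε z)) (f ε z) (pderiv j (pderiv i φ))) := by
  have h1 := H.kinO.moment_transport H.isOpen H.velocity hε hz φ
  have h2 : transport (f ε) z = fun v => 1 / ε * collision R ν (τ ε z) (f ε z) v :=
    funext fun v => H.solution ε hε z hz v
  rw [h2, moment_fun_const_mul, H.kinO.moment_collision H.isOpen hε hz] at h1
  rw [dt, fderiv_congr_of_isOpen H.isOpen hA hz]
  simp only [dx, fderiv_congr_of_isOpen H.isOpen (hB _) hz]
  rw [← mul_assoc, one_div_mul_one_div] at h1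
  exact h1.symm

theorem mass_balance {ε : ℝ} (hε : ε ∈ Ioo 0 ε₀) {z : SpaceTime} (hz : z ∈ Ω) :
    dt (fun y => density (f ε y)) z +
      ∑ k, dx k (fun y => density (f ε y) * ESFP.velocity (f ε y) k) z = 0 := by
  have := H.balance hε hz 1 (A := fun y => density (f ε y))
    (B := fun k y => density (f ε y) * ESFP.velocity (f ε y) k)
    (fun y _ => by rw [moment_one])
    (fun k y hy => by rw [mul_one, H.moment_X hε hy, moment_one]; ring)
  simpa [moment_zero] using this

/-- The first centred moment vanishes identically, so the time derivative enters only through the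
moving weight and the law comes out in non-conservative form. -/
theorem momentum_balance {ε : ℝ} (hε : ε ∈ Ioo 0 ε₀) {z : SpaceTime} (hz : z ∈ Ω) (i : Fin 3) :
    density (f ε z) * acceleration (fun y => ESFP.velocity (f ε y)) i z +
      ∑ k, dx k (fun y => stress (f ε y) k i) z = 0 := by
  have := H.balance hε hz (X i) (A := fun _ => 0) (B := fun k y => stress (f ε y) k i)
    (fun y hy => by rw [H.moment_X hε hy])
    (fun k y hy => by rw [H.moment_X hε hy, moment_X_mul_X]; ring)
  simp only [pderiv_X_eq, mul_comm _ (C _), moment_C, moment_C_mul, moment_one, H.moment_X hε hz,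
    pderiv_C, moment_zero, dt] at this
  simp at this
  linarith

/-- The quadratic weight gives -2Σ + 2ρΠ on the collision side; inserting ρΠ = (1-ν)pI + νΣ leaves
relaxation of Σ to pI at rate 2(1-ν). -/
theorem stress_balance {ε : ℝ} (hε : ε ∈ Ioo 0 ε₀) {z : SpaceTime} (hz : z ∈ Ω) (i j : Fin 3) :
    dt (fun y => stress (f ε y) i j) z +
      ∑ k, dx k (fun y => moment (ESFP.velocity (f ε y)) (f ε y) (X k * (X i * X j)) +
        ESFP.velocity (f ε y) k * stress (f ε y) i j) z +
      (∑ k, dx k (fun y => ESFP.velocity (f ε y) i) z * stress (f ε z) k j +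
        ∑ k, dx k (fun y => ESFP.velocity (f ε y) j) z * stress (f ε z) k i) =
      -(2 * (1 - ν) / (ε * τ ε z)) *
        (stress (f ε z) i j - ESFP.pressure R (f ε z) * (if i = j then 1 else 0)) := by
  have hm := H.hasMoments hε hz
  have := H.balance hε hz (X i * X j) (A := fun y => stress (f ε y) i j)
    (B := fun k y => moment (ESFP.velocity (f ε y)) (f ε y) (X k * (X i * X j)) +
        ESFP.velocity (f ε y) k * stress (f ε y) i j)
    (fun y _ => by rw [moment_X_mul_X]) (fun k y _ => by rw [moment_X_mul_X])
  simp only [pderiv_X_mul_X, pderiv_C_mul, pderiv_X_eq, map_add, mul_add, mul_left_comm _ (C _),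
    moment_C, moment_C_mul, moment_one, moment_add hm, H.moment_X hε hz, moment_X_mul_X,
    ← C_mul] at this
  simp [Finset.sum_add_distrib] at this
  have hP : ∀ a b, PiTensor R ν (f ε z) a b * density (f ε z) =
      (1 - ν) * ESFP.pressure R (f ε z) * (if a = b then 1 else 0) + ν * stress (f ε z) a b :=
    fun a b => by rw [mul_comm, density_mul_PiTensor (H.density_ne_zero hε hz)]
  rw [this, hP, hP, stress_comm j i]
  simp only [eq_comm (a := j)]
  ring

/-- For the weight |c|² the collision side vanishes because ρΠ and Σ both have trace 3p. -/
theorem internal_energy_balance {ε : ℝ} (hε : ε ∈ Ioo 0 ε₀) {z : SpaceTime} (hz : z ∈ Ω) :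
    3 / 2 * (dt (fun y => ESFP.pressure R (f ε y)) z +
        ∑ k, dx k (fun y => ESFP.pressure R (f ε y) * ESFP.velocity (f ε y) k) z) +
      ∑ k, dx k (fun y => heatFlux (f ε y) k) z +
      ∑ l, ∑ k, dx k (fun y => ESFP.velocity (f ε y) l) z * stress (f ε z) k l = 0 := by
  have hm := H.hasMoments hε hz
  have htr : ∀ y ∈ Ω, moment (ESFP.velocity (f ε y)) (f ε y) normSqPoly =
      3 * ESFP.pressure R (f ε y) := fun y hy => by
    rw [moment_normSqPoly (H.hasMoments hε hy),
      sum_stress (H.hasMoments hε hy) (H.density_ne_zero hε hy) H.R_ne_zero]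
  have hp : DifferentiableAt ℝ (fun y => ESFP.pressure R (f ε y)) z :=
    H.pressure.differentiableAt H.isOpen hε hz
  have hu : ∀ k, DifferentiableAt ℝ (fun y => ESFP.velocity (f ε y) k) z := fun k =>
    (H.velocity k).differentiableAt H.isOpen hε hz
  have hq : ∀ k, DifferentiableAt ℝ (fun y => heatFlux (f ε y) k) z := fun k =>
    ((H.orderO_heatFlux k).macroO H.isOpen).differentiableAt H.isOpen hε hz
  have := H.balance hε hz normSqPoly (A := fun y => 3 * ESFP.pressure R (f ε y))
    (B := fun k y => 2 * heatFlux (f ε y) k +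
      3 * (ESFP.pressure R (f ε y) * ESFP.velocity (f ε y) k))
    (fun y hy => by rw [htr y hy]) (fun k y hy => by
      rw [moment_X_mul_normSqPoly, htr y hy]; ring)
  simp only [pderiv_normSqPoly, pderiv_C_mul, pderiv_X_eq, mul_left_comm _ (C _),
    moment_C, moment_C_mul, moment_one, H.moment_X hε hz, moment_X_mul_X,
    ← C_mul] at this
  have hP : ∑ i, PiTensor R ν (f ε z) i i * density (f ε z) =
      3 * ESFP.pressure R (f ε z) := by
    simp only [mul_comm _ (density _), density_mul_PiTensor (H.density_ne_zero hε hz)]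
    have h1 := sum_stress hm (H.density_ne_zero hε hz) H.R_ne_zero
    simp only [Finset.sum_add_distrib, ← Finset.mul_sum, h1]
    simp
    ring
  have hS := sum_stress hm (H.density_ne_zero hε hz) H.R_ne_zero
  have hrhs : -∑ i, 2 * stress (f ε z) i i + ∑ i, ∑ j, PiTensor R ν (f ε z) i j *
      ((2 * if i = j then 1 else 0) * density (f ε z)) = 0 := by
    simp only [← Finset.mul_sum, hS]
    simp [mul_left_comm _ (2 : ℝ), ← Finset.mul_sum, hP]
  rw [hrhs] at this
  simp only [Fin.sum_univ_three, dt, dx] at this ⊢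
  simp (disch := fun_prop) only [fderiv_mul_dir, fderiv_add_dir, fderiv_const_dir] at this ⊢
  linear_combination 1 / 2 * this

/-- By Euler's identity the drift multiplies the cubic weight by -3, while its second derivatives
are linear and have zero mean. Hence the rate 3 does not depend on ν. -/
theorem heatFlux_balance {ε : ℝ} (hε : ε ∈ Ioo 0 ε₀) {z : SpaceTime} (hz : z ∈ Ω) (i : Fin 3) :
    dt (fun y => 2 * heatFlux (f ε y) i) z +
      ∑ k, dx k (fun y => moment (ESFP.velocity (f ε y)) (f ε y) (X k * (X i * normSqPoly)) +
        2 * (ESFP.velocity (f ε y) k * heatFlux (f ε y) i)) z +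
      (acceleration (fun y => ESFP.velocity (f ε y)) i z * (3 * ESFP.pressure R (f ε z)) +
        2 * ∑ l, acceleration (fun y => ESFP.velocity (f ε y)) l z * stress (f ε z) i l +
        2 * ∑ k, dx k (fun y => ESFP.velocity (f ε y) i) z * heatFlux (f ε z) k +
        2 * ∑ l, ∑ k, dx k (fun y => ESFP.velocity (f ε y) l) z *
          moment (ESFP.velocity (f ε z)) (f ε z) (X k * (X i * X l))) =
      -(3 / (ε * τ ε z)) * (2 * heatFlux (f ε z) i) := by
  have hm := H.hasMoments hε hz
  have htr : moment (ESFP.velocity (f ε z)) (f ε z) normSqPoly =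
      3 * ESFP.pressure R (f ε z) := by
    rw [moment_normSqPoly hm, sum_stress hm (H.density_ne_zero hε hz) H.R_ne_zero]
  have h1 : ∀ l, moment (ESFP.velocity (f ε z)) (f ε z) (pderiv l (X i * normSqPoly)) =
      (if i = l then 1 else 0) * (3 * ESFP.pressure R (f ε z)) + 2 * stress (f ε z) i l := by
    intro l
    rw [pderiv_X_mul_normSqPoly, moment_add hm, moment_C_mul, moment_C_mul, htr, moment_X_mul_X]
  have h2 : ∀ k l, moment (ESFP.velocity (f ε z)) (f ε z)
      (X k * pderiv l (X i * normSqPoly)) = (if i = l then 1 else 0) * (2 * heatFlux (f ε z) k) +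
        2 * moment (ESFP.velocity (f ε z)) (f ε z) (X k * (X i * X l)) := by
    intro k l
    rw [pderiv_X_mul_normSqPoly, mul_add, mul_left_comm, mul_left_comm (X k) (C 2),
      moment_add hm, moment_C_mul, moment_C_mul, moment_X_mul_normSqPoly]
  have h3 : ∀ j l, moment (ESFP.velocity (f ε z)) (f ε z)
      (pderiv j (pderiv l (X i * normSqPoly))) = 0 := by
    intro j l
    simp only [pderiv_X_mul_normSqPoly, map_add, pderiv_C_mul, pderiv_normSqPoly, pderiv_X_mul_X,
      moment_add hm, moment_C_mul, H.moment_X hε hz, mul_zero, add_zero]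
  have h4 : ∑ l, moment (ESFP.velocity (f ε z)) (f ε z) (X l * (X i * X l)) =
      2 * heatFlux (f ε z) i := by
    rw [← moment_X_mul_normSqPoly, normSqPoly, Finset.mul_sum, moment_sum hm]
    exact Finset.sum_congr rfl fun l _ => by rw [mul_left_comm]
  have := H.balance hε hz (X i * normSqPoly) (A := fun y => 2 * heatFlux (f ε y) i)
    (B := fun k y => moment (ESFP.velocity (f ε y)) (f ε y) (X k * (X i * normSqPoly)) +
        2 * (ESFP.velocity (f ε y) k * heatFlux (f ε y) i))
    (fun y _ => by rw [moment_X_mul_normSqPoly])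
    (fun k y _ => by rw [moment_X_mul_normSqPoly]; ring)
  simp only [h1, h2, h3, mul_zero, Finset.sum_const_zero, mul_add, Finset.sum_add_distrib,
    ← mul_assoc, mul_comm _ (2 : ℝ)] at this
  simp only [mul_assoc, ← Finset.mul_sum, h4] at this
  simp only [ite_mul, mul_ite, one_mul, zero_mul, mul_zero, Finset.sum_ite_eq, Finset.mem_univ,
    if_true, Finset.sum_ite_irrel, Finset.sum_const_zero] at this
  linear_combination this

theorem temperature : MacroO ε₀ Ω 2 fun ε z => temperature R (f ε z) :=
  H.kinO.temperature H.isOpen H.noVacuum H.R_ne_zero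

theorem acceleration (l : Fin 3) :
    MacroO ε₀ Ω 1 fun ε => acceleration (fun y => ESFP.velocity (f ε y)) l :=
  ((H.velocity l).dir (1, 0)).add H.isOpen (MacroO.sum H.isOpen Finset.univ fun k =>
    (H.velocity k).of_succ.mul H.isOpen ((H.velocity l).dir (0, e k)))

/-- The stress tensor is the Newtonian one, up to `O(ε²)`. -/
theorem orderO_stress_sub_newtonian (i j : Fin 3) : OrderO ε₀ Ω 2 1 fun ε z =>
    stress (f ε z) i j - (ESFP.pressure R (f ε z) * (if i = j then 1 else 0) +
      shearStress (fun z => ε * viscosity ν (τ ε z) (ESFP.pressure R (f ε z)))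
        (fun z => ESFP.velocity (f ε z)) i j z) := by
  have hΩ := H.isOpen
  have hd := H.orderO_stress
  have hdu : ∀ k l, MacroO ε₀ Ω 1 fun ε z => dx k (fun y => ESFP.velocity (f ε y) l) z :=
    fun k l => (H.velocity l).dir (0, e k)
  -- This is the transport side of the stress balance minus its Newtonian leading part: every term
  -- contains Σ - pI, a third moment or q. The last bracket remains after ∂_t p + ∇·(pu) is
  -- eliminated by the internal energy balance, which also produces the -2/3 ∇·u of the Newtonian
  -- law.
  have hZ : OrderO ε₀ Ω 1 1 fun ε z =>
      dt (fun y => stress (f ε y) i j - ESFP.pressure R (f ε y) * (if i = j then 1 else 0)) z +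
      ∑ k, dx k (fun y => moment (ESFP.velocity (f ε y)) (f ε y) (X k * (X i * X j)) +
        (stress (f ε y) i j - ESFP.pressure R (f ε y) * (if i = j then 1 else 0)) *
          ESFP.velocity (f ε y) k) z +
      (∑ k, (stress (f ε z) k j - ESFP.pressure R (f ε z) * (if k = j then 1 else 0)) *
          dx k (fun y => ESFP.velocity (f ε y) i) z +
        ∑ k, (stress (f ε z) k i - ESFP.pressure R (f ε z) * (if k = i then 1 else 0)) *
          dx k (fun y => ESFP.velocity (f ε y) j) z) +
      -(2 / 3) * (if i = j then 1 else 0) * (∑ k, dx k (fun y => heatFlux (f ε y) k) z +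
        ∑ l, ∑ k, (stress (f ε z) k l - ESFP.pressure R (f ε z) * (if k = l then 1 else 0)) *
          dx k (fun y => ESFP.velocity (f ε y) l) z) :=
    ((((hd i j).dir hΩ (1, 0)).add hΩ (OrderO.sum hΩ _ fun k =>
      ((H.orderO_third k i j).add hΩ ((hd i j).mul_macroO hΩ (H.velocity k))).dir hΩ
        (0, e k))).add hΩ ((OrderO.sum hΩ _ fun k => (hd k j).of_succ.mul_macroO hΩ
          (hdu k i)).add hΩ (OrderO.sum hΩ _ fun k => (hd k i).of_succ.mul_macroO hΩ
            (hdu k j)))).add hΩ (((OrderO.sum hΩ _ fun k =>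
              (H.orderO_heatFlux k).dir hΩ (0, e k)).add hΩ (OrderO.sum hΩ _ fun l =>
                OrderO.sum hΩ _ fun k => (hd k l).of_succ.mul_macroO hΩ (hdu k l))).const_mul hΩ _)
  -- Dividing by the relaxation rate 2(1-ν)/(ετ) contributes the second factor ε.
  refine (((hZ.mul_macroO hΩ H.macroO_τ).const_mul hΩ (-(2 * (1 - ν))⁻¹)).eps_mul hΩ).congr hΩ
    fun ε hε z hz => ?_
  have hs : ∀ i j, DifferentiableAt ℝ (fun y => stress (f ε y) i j) z := fun i j =>
    (H.kinO.stress hΩ H.noVacuum i j).differentiableAt hΩ hε hz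
  have hp : DifferentiableAt ℝ (fun y => ESFP.pressure R (f ε y)) z :=
    H.pressure.differentiableAt hΩ hε hz
  have hu : ∀ k, DifferentiableAt ℝ (fun y => ESFP.velocity (f ε y) k) z := fun k =>
    (H.velocity k).differentiableAt hΩ hε hz
  have hm : ∀ φ, DifferentiableAt ℝ
      (fun y => moment (ESFP.velocity (f ε y)) (f ε y) φ) z := fun φ =>
    (H.kinO.central_moment hΩ H.noVacuum φ).differentiableAt hΩ hε hz
  have b1 := H.stress_balance hε hz i j
  have b2 := H.internal_energy_balance hε hz
  have e1 : ∀ i j, ∑ k, (stress (f ε z) k j - ESFP.pressure R (f ε z) * (if k = j then 1 else 0)) *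
      dx k (fun y => ESFP.velocity (f ε y) i) z =
      ∑ k, dx k (fun y => ESFP.velocity (f ε y) i) z * stress (f ε z) k j -
        ESFP.pressure R (f ε z) * dx j (fun y => ESFP.velocity (f ε y) i) z := by
    intro i j
    simp [sub_mul, Finset.sum_sub_distrib, mul_comm]
  have e2 : dt (fun y => stress (f ε y) i j - ESFP.pressure R (f ε y) *
      (if i = j then 1 else 0)) z = dt (fun y => stress (f ε y) i j) z -
        dt (fun y => ESFP.pressure R (f ε y)) z * (if i = j then 1 else 0) := by
    simp (disch := fun_prop) only [dt, fderiv_sub_dir, fderiv_mul_dir, fderiv_const_dir]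
    ring
  have e3 : ∑ k, dx k (fun y => moment (ESFP.velocity (f ε y)) (f ε y) (X k * (X i * X j)) +
        (stress (f ε y) i j - ESFP.pressure R (f ε y) * (if i = j then 1 else 0)) *
          ESFP.velocity (f ε y) k) z =
      ∑ k, dx k (fun y => moment (ESFP.velocity (f ε y)) (f ε y) (X k * (X i * X j)) +
        ESFP.velocity (f ε y) k * stress (f ε y) i j) z -
      (∑ k, dx k (fun y => ESFP.pressure R (f ε y) * ESFP.velocity (f ε y) k) z) *
        (if i = j then 1 else 0) := by
    rw [Finset.sum_mul, ← Finset.sum_sub_distrib]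
    refine Finset.sum_congr rfl fun k _ => ?_
    simp (disch := fun_prop) only [dx, fderiv_add_dir, fderiv_sub_dir, fderiv_mul_dir,
      fderiv_const_dir]
    ring
  simp only [e1, e2, e3, Finset.sum_sub_distrib, ← Finset.mul_sum, shearStress, divergence,
    viscosity]
  have h1 : 1 - ν ≠ 0 := by linarith [H.ν_lt_one]
  have h2 : ε ≠ 0 := hε.1.ne'
  have h3 : τ ε z ≠ 0 := (H.τ_pos ε hε z hz).ne'
  -- The deviation is rewritten as a multiple of the collision side so that the balance can be
  -- substituted.
  have b3 : stress (f ε z) i j - ESFP.pressure R (f ε z) * (if i = j then 1 else 0) =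
      -(ε * τ ε z * (2 * (1 - ν))⁻¹) * (-(2 * (1 - ν) / (ε * τ ε z)) *
        (stress (f ε z) i j - ESFP.pressure R (f ε z) * (if i = j then 1 else 0))) := by
    field_simp
  rw [← b1] at b3
  rw [div_eq_mul_inv]
  linear_combination b3 - (ε * τ ε z * (2 * (1 - ν))⁻¹) * (2 / 3) * (if i = j then 1 else 0) * b2

/-- The heat flux is given by Fourier's law, up to `O(ε²)`. -/
theorem orderO_heatFlux_sub_fourier (i : Fin 3) : OrderO ε₀ Ω 2 1 fun ε z =>
    heatFlux (f ε z) i -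
      fourierFlux (fun z => ε * conductivity R (τ ε z) (ESFP.pressure R (f ε z)))
        (fun z => ESFP.temperature R (f ε z)) i z := by
  have hΩ := H.isOpen
  have hd := H.orderO_stress
  have hdu : ∀ k l, MacroO ε₀ Ω 1 fun ε z => dx k (fun y => ESFP.velocity (f ε y) l) z :=
    fun k l => (H.velocity l).dir (0, e k)
  -- The leading transport terms are 5∂_i(pθ) + 5p a_i, with θ = RT and a the acceleration. Since p
  -- = ρθ and ρa_i = -∑∂_kΣ_ki, they reduce to 5p∂_iθ plus an error, which is the last term here;
  -- the rest is O(ε) term by term.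
  have hZ : OrderO ε₀ Ω 1 1 fun ε z =>
      dt (fun y => 2 * heatFlux (f ε y) i) z +
      ∑ k, dx k (fun y => (moment (ESFP.velocity (f ε y)) (f ε y) (X k * (X i * normSqPoly)) -
        5 * (ESFP.pressure R (f ε y) * (R * ESFP.temperature R (f ε y))) *
          (if k = i then 1 else 0)) + 2 * (heatFlux (f ε y) i * ESFP.velocity (f ε y) k)) z +
      (2 * ∑ l, (stress (f ε z) i l - ESFP.pressure R (f ε z) * (if i = l then 1 else 0)) *
          ESFP.acceleration (fun y => ESFP.velocity (f ε y)) l z +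
        2 * ∑ k, heatFlux (f ε z) k * dx k (fun y => ESFP.velocity (f ε y) i) z +
        2 * ∑ l, ∑ k, moment (ESFP.velocity (f ε z)) (f ε z) (X k * (X i * X l)) *
          dx k (fun y => ESFP.velocity (f ε y) l) z) +
      -5 * ((∑ k, dx k (fun y => stress (f ε y) k i - ESFP.pressure R (f ε y) *
        (if k = i then 1 else 0)) z) * (R * ESFP.temperature R (f ε z))) := by
    have hq := H.orderO_heatFlux
    exact ((((hq i).const_mul hΩ 2).dir hΩ (1, 0)).add hΩ (OrderO.sum hΩ _ fun k =>
      ((H.orderO_fourth k i).add hΩ (((hq i).mul_macroO hΩ (H.velocity k)).const_mul hΩ 2)).dir hΩ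
        (0, e k))).add hΩ ((((OrderO.sum hΩ _ fun l => (hd i l).of_succ.mul_macroO hΩ
          (H.acceleration l)).const_mul hΩ 2).add hΩ ((OrderO.sum hΩ _ fun k =>
            (hq k).of_succ.mul_macroO hΩ (hdu k i)).const_mul hΩ 2)).add hΩ
              ((OrderO.sum hΩ _ fun l => OrderO.sum hΩ _ fun k =>
                (H.orderO_third k i l).of_succ.mul_macroO hΩ (hdu k l)).const_mul hΩ 2))
        |>.add hΩ (((OrderO.sum hΩ _ fun k => (hd k i).dir hΩ (0, e k)).mul_macroO hΩ
          (H.temperature.of_succ.const_mul hΩ R)).const_mul hΩ (-5))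
  -- The constant 1/6 combines the rate 3 with the factor 2 in ⟨c_i|c|²f⟩ = 2q_i; with the 5 above
  -- it yields the 5/6 in κ.
  refine (((hZ.mul_macroO hΩ H.macroO_τ).const_mul hΩ (-(1 / 6))).eps_mul hΩ).congr hΩ
    fun ε hε z hz => ?_
  have hs : ∀ i j, DifferentiableAt ℝ (fun y => stress (f ε y) i j) z := fun i j =>
    (H.kinO.stress hΩ H.noVacuum i j).differentiableAt hΩ hε hz
  have hp : DifferentiableAt ℝ (fun y => ESFP.pressure R (f ε y)) z :=
    H.pressure.differentiableAt hΩ hε hz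
  have hT : DifferentiableAt ℝ (fun y => ESFP.temperature R (f ε y)) z :=
    H.temperature.differentiableAt hΩ hε hz
  have hu : ∀ k, DifferentiableAt ℝ (fun y => ESFP.velocity (f ε y) k) z := fun k =>
    (H.velocity k).differentiableAt hΩ hε hz
  have hq : ∀ k, DifferentiableAt ℝ (fun y => heatFlux (f ε y) k) z := fun k =>
    ((H.orderO_heatFlux k).macroO H.isOpen).differentiableAt H.isOpen hε hz
  have hm : ∀ φ, DifferentiableAt ℝ
      (fun y => moment (ESFP.velocity (f ε y)) (f ε y) φ) z := fun φ =>
    (H.kinO.central_moment hΩ H.noVacuum φ).differentiableAt hΩ hε hz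
  have b1 := H.heatFlux_balance hε hz i
  have b2 := H.momentum_balance hε hz i
  have e1 : ∑ l, (stress (f ε z) i l - ESFP.pressure R (f ε z) * (if i = l then 1 else 0)) *
      ESFP.acceleration (fun y => ESFP.velocity (f ε y)) l z =
      ∑ l, ESFP.acceleration (fun y => ESFP.velocity (f ε y)) l z * stress (f ε z) i l -
        ESFP.pressure R (f ε z) * ESFP.acceleration (fun y => ESFP.velocity (f ε y)) i z := by
    simp [sub_mul, Finset.sum_sub_distrib, mul_comm]
  have e2 : ∑ k, dx k (fun y => stress (f ε y) k i - ESFP.pressure R (f ε y) *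
        (if k = i then 1 else 0)) z = ∑ k, dx k (fun y => stress (f ε y) k i) z -
      dx i (fun y => ESFP.pressure R (f ε y)) z := by
    simp (disch := fun_prop) only [dx, fderiv_sub_dir, fderiv_mul_dir, fderiv_const_dir]
    simp
  have e3 : ∑ k, dx k (fun y => (moment (ESFP.velocity (f ε y)) (f ε y)
        (X k * (X i * normSqPoly)) - 5 * (ESFP.pressure R (f ε y) *
          (R * ESFP.temperature R (f ε y))) * (if k = i then 1 else 0)) +
            2 * (heatFlux (f ε y) i * ESFP.velocity (f ε y) k)) z =
      ∑ k, dx k (fun y => moment (ESFP.velocity (f ε y)) (f ε y) (X k * (X i * normSqPoly)) +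
        2 * (ESFP.velocity (f ε y) k * heatFlux (f ε y) i)) z -
      5 * R * (dx i (fun y => ESFP.pressure R (f ε y)) z * ESFP.temperature R (f ε z) +
        ESFP.pressure R (f ε z) * dx i (fun y => ESFP.temperature R (f ε y)) z) := by
    have : ∀ k, dx k (fun y => (moment (ESFP.velocity (f ε y)) (f ε y)
        (X k * (X i * normSqPoly)) - 5 * (ESFP.pressure R (f ε y) *
          (R * ESFP.temperature R (f ε y))) * (if k = i then 1 else 0)) +
            2 * (heatFlux (f ε y) i * ESFP.velocity (f ε y) k)) z =
      dx k (fun y => moment (ESFP.velocity (f ε y)) (f ε y) (X k * (X i * normSqPoly)) +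
        2 * (ESFP.velocity (f ε y) k * heatFlux (f ε y) i)) z -
      (if k = i then 5 * R * (dx k (fun y => ESFP.pressure R (f ε y)) z *
        ESFP.temperature R (f ε z) +
        ESFP.pressure R (f ε z) * dx k (fun y => ESFP.temperature R (f ε y)) z) else 0) := by
      intro k
      simp (disch := fun_prop) only [dx, fderiv_add_dir, fderiv_sub_dir, fderiv_mul_dir,
        fderiv_const_dir]
      split_ifs <;> ring
    simp only [this, Finset.sum_sub_distrib, Finset.sum_ite_eq', Finset.mem_univ, if_true]
  simp only [e1, e2, e3, fourierFlux, conductivity, mul_comm (heatFlux _ _) (dx _ _ _),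
    mul_comm (moment _ _ _) (dx _ _ _)]
  have h2 : ε ≠ 0 := hε.1.ne'
  have h3 : τ ε z ≠ 0 := (H.τ_pos ε hε z hz).ne'
  have b3 : heatFlux (f ε z) i =
      -(ε * τ ε z * (1 / 6)) * (-(3 / (ε * τ ε z)) * (2 * heatFlux (f ε z) i)) := by
    field_simp
    ring
  rw [← b1] at b3
  have b4 : ESFP.pressure R (f ε z) = density (f ε z) * R * ESFP.temperature R (f ε z) := rfl
  linear_combination b3 - (5 / 6) * ε * τ ε z * R * ESFP.temperature R (f ε z) * b2 -
    (5 / 6) * ε * τ ε z * ESFP.acceleration (fun y => ESFP.velocity (f ε y)) i z * b4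

/-! ### The Navier-Stokes equations -/

theorem energy_eq {ε : ℝ} (hε : ε ∈ Ioo 0 ε₀) {z : SpaceTime} (hz : z ∈ Ω) :
    energy (f ε z) = 1 / 2 * (density (f ε z) *
      ∑ l, ESFP.velocity (f ε z) l * ESFP.velocity (f ε z) l) +
        3 / 2 * ESFP.pressure R (f ε z) := by
  have hm := H.hasMoments hε hz
  have hρ := H.density_ne_zero hε hz
  rw [ESFP.energy_eq hm hρ, sum_stress hm hρ H.R_ne_zero, EuclideanSpace.real_norm_sq_eq]
  simp only [pow_two]
  ring

/-- The momentum equation holds up to the divergence of the error made on the stress tensor. -/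
theorem momentumResidual_eq {ε : ℝ} (hε : ε ∈ Ioo 0 ε₀) {z : SpaceTime} (hz : z ∈ Ω)
    {σ : Fin 3 → Fin 3 → SpaceTime → ℝ} (hσ : ∀ i j, DifferentiableAt ℝ (σ i j) z) (i : Fin 3) :
    momentumResidual (fun z => density (f ε z)) (fun z => ESFP.velocity (f ε z))
      (fun z => ESFP.pressure R (f ε z)) σ i z =
      -∑ j, dx j (fun y => stress (f ε y) i j -
        (ESFP.pressure R (f ε y) * (if i = j then 1 else 0) + σ i j y)) z := by
  have hΩ := H.isOpen
  have hs : ∀ i j, DifferentiableAt ℝ (fun y => stress (f ε y) i j) z := fun i j =>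
    (H.kinO.stress hΩ H.noVacuum i j).differentiableAt hΩ hε hz
  have hp : DifferentiableAt ℝ (fun y => ESFP.pressure R (f ε y)) z :=
    H.pressure.differentiableAt hΩ hε hz
  have hu : ∀ k, DifferentiableAt ℝ (fun y => ESFP.velocity (f ε y) k) z := fun k =>
    (H.velocity k).differentiableAt hΩ hε hz
  have hρ : DifferentiableAt ℝ (fun y => density (f ε y)) z :=
    (H.kinO.density hΩ).differentiableAt hΩ hε hz
  have b1 := H.mass_balance hε hz
  have b2 := H.momentum_balance hε hz i
  have e1 : ∑ j, dx j (fun y => stress (f ε y) i j -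
        (ESFP.pressure R (f ε y) * (if i = j then 1 else 0) + σ i j y)) z =
      ∑ k, dx k (fun y => stress (f ε y) k i) z - dx i (fun y => ESFP.pressure R (f ε y)) z -
        ∑ j, dx j (σ i j) z := by
    simp (disch := fun_prop) only [dx, fderiv_sub_dir, fderiv_add_dir, fderiv_mul_dir,
      fderiv_const_dir, stress_comm i]
    simp [Finset.sum_sub_distrib, Finset.sum_add_distrib, sub_sub]
  rw [e1, momentumResidual]
  simp only [ESFP.acceleration, Fin.sum_univ_three, dt, dx] at b1 b2 ⊢
  simp (disch := fun_prop) only [fderiv_mul_dir] at b1 b2 ⊢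
  linear_combination b2 + ESFP.velocity (f ε z) i * b1

/-- The energy equation holds up to the divergence of the errors made on the stress tensor and on
the heat flux. -/
theorem energyResidual_eq {ε : ℝ} (hε : ε ∈ Ioo 0 ε₀) {z : SpaceTime} (hz : z ∈ Ω)
    {σ : Fin 3 → Fin 3 → SpaceTime → ℝ} (hσ : ∀ i j, DifferentiableAt ℝ (σ i j) z)
    {q : Fin 3 → SpaceTime → ℝ} (hq' : ∀ i, DifferentiableAt ℝ (q i) z) :
    energyResidual (fun z => energy (f ε z)) (fun z => ESFP.velocity (f ε z))
      (fun z => ESFP.pressure R (f ε z)) σ q z =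
      -(∑ j, dx j (fun y => heatFlux (f ε y) j - q j y) z +
        ∑ j, dx j (fun y => ∑ k, (stress (f ε y) j k - (ESFP.pressure R (f ε y) *
          (if j = k then 1 else 0) + σ j k y)) * ESFP.velocity (f ε y) k) z) := by
  have hΩ := H.isOpen
  have hs : ∀ i j, DifferentiableAt ℝ (fun y => stress (f ε y) i j) z := fun i j =>
    (H.kinO.stress hΩ H.noVacuum i j).differentiableAt hΩ hε hz
  have hp : DifferentiableAt ℝ (fun y => ESFP.pressure R (f ε y)) z :=
    H.pressure.differentiableAt hΩ hε hz
  have hu : ∀ k, DifferentiableAt ℝ (fun y => ESFP.velocity (f ε y) k) z := fun k =>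
    (H.velocity k).differentiableAt hΩ hε hz
  have hρ : DifferentiableAt ℝ (fun y => density (f ε y)) z :=
    (H.kinO.density hΩ).differentiableAt hΩ hε hz
  have hq : ∀ k, DifferentiableAt ℝ (fun y => heatFlux (f ε y) k) z := fun k =>
    ((H.orderO_heatFlux k).macroO hΩ).differentiableAt hΩ hε hz
  have b1 := total_energy_balance (u := fun k y => ESFP.velocity (f ε y) k)
    (s := fun k l y => stress (f ε y) k l) hρ hp hu hs
    (H.mass_balance hε hz) (H.momentum_balance hε hz) (H.internal_energy_balance hε hz)
  have e1 : dt (fun y => energy (f ε y)) z = dt (fun y => 1 / 2 * (density (f ε y) *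
      ∑ l, ESFP.velocity (f ε y) l * ESFP.velocity (f ε y) l) +
        3 / 2 * ESFP.pressure R (f ε y)) z := by
    rw [dt, dt, fderiv_congr_of_isOpen hΩ (fun y hy => H.energy_eq hε hy) hz]
  have e2 : ∀ j, dx j (fun y => (energy (f ε y) + ESFP.pressure R (f ε y)) *
        ESFP.velocity (f ε y) j) z =
      dx j (fun y => (1 / 2 * (density (f ε y) *
        ∑ l, ESFP.velocity (f ε y) l * ESFP.velocity (f ε y) l) +
          3 / 2 * ESFP.pressure R (f ε y) + ESFP.pressure R (f ε y)) *
            ESFP.velocity (f ε y) j) z := fun j => by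
    rw [dx, dx, fderiv_congr_of_isOpen hΩ (fun y hy => by rw [H.energy_eq hε hy]) hz]
  have e3 : ∀ j, (fun y => ∑ k, (stress (f ε y) j k - (ESFP.pressure R (f ε y) *
          (if j = k then 1 else 0) + σ j k y)) * ESFP.velocity (f ε y) k) = fun y =>
      (∑ k, stress (f ε y) j k * ESFP.velocity (f ε y) k) -
        ESFP.pressure R (f ε y) * ESFP.velocity (f ε y) j -
          ∑ k, σ j k y * ESFP.velocity (f ε y) k := fun j => by
    funext y
    simp [sub_mul, add_mul, Finset.sum_sub_distrib, Finset.sum_add_distrib, sub_sub]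
  rw [energyResidual, e1]
  simp only [e2, e3]
  simp only [Fin.sum_univ_three, dt, dx] at b1 ⊢
  simp (disch := fun_prop) only [fderiv_add_dir, fderiv_sub_dir, fderiv_mul_dir,
    fderiv_const_dir] at b1 ⊢
  linear_combination b1

/-- σ is recovered as Σ - pI minus the remainder, all of which are already controlled with one
derivative. -/
theorem macroO_shearStress (i j : Fin 3) : MacroO ε₀ Ω 1 fun ε =>
    shearStress (fun z => ε * viscosity ν (τ ε z) (ESFP.pressure R (f ε z)))
      (fun z => ESFP.velocity (f ε z)) i j := by
  have hΩ := H.isOpen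
  have hs := H.kinO.stress hΩ H.noVacuum i j
  refine (hs.of_succ.add hΩ (((H.pressure.of_succ.const_mul hΩ (if i = j then 1 else 0)).add hΩ
    ((H.orderO_stress_sub_newtonian i j).macroO hΩ)).const_mul hΩ (-1))).congr hΩ
      fun ε _ z _ => ?_
  ring

theorem macroO_fourierFlux (i : Fin 3) : MacroO ε₀ Ω 1 fun ε =>
    fourierFlux (fun z => ε * conductivity R (τ ε z) (ESFP.pressure R (f ε z)))
        (fun z => ESFP.temperature R (f ε z)) i := by
  have hΩ := H.isOpen
  refine (((H.orderO_heatFlux i).macroO hΩ).of_succ.add hΩ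
    (((H.orderO_heatFlux_sub_fourier i).macroO hΩ).const_mul hΩ (-1))).congr hΩ
      fun ε _ z _ => ?_
  ring

/-- The stress error is O(ε²) together with its first derivatives, and the divergence spends that
last derivative. -/
theorem orderO_momentumResidual (i : Fin 3) : OrderO ε₀ Ω 2 0 fun ε =>
    momentumResidual (fun z => density (f ε z)) (fun z => ESFP.velocity (f ε z))
      (fun z => ESFP.pressure R (f ε z))
      (shearStress (fun z => ε * viscosity ν (τ ε z) (ESFP.pressure R (f ε z)))
        (fun z => ESFP.velocity (f ε z))) i := by
  have hΩ := H.isOpen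
  refine ((OrderO.sum hΩ Finset.univ fun j =>
    (H.orderO_stress_sub_newtonian i j).dir hΩ (0, e j)).const_mul hΩ (-1)).congr hΩ
      fun ε hε z hz => ?_
  rw [H.momentumResidual_eq hε hz fun i j =>
    (H.macroO_shearStress i j).differentiableAt hΩ hε hz, neg_one_mul]
  rfl

theorem orderO_energyResidual : OrderO ε₀ Ω 2 0 fun ε =>
    energyResidual (fun z => energy (f ε z)) (fun z => ESFP.velocity (f ε z))
      (fun z => ESFP.pressure R (f ε z))
      (shearStress (fun z => ε * viscosity ν (τ ε z) (ESFP.pressure R (f ε z)))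
        (fun z => ESFP.velocity (f ε z)))
      (fourierFlux (fun z => ε * conductivity R (τ ε z) (ESFP.pressure R (f ε z)))
        (fun z => ESFP.temperature R (f ε z))) := by
  have hΩ := H.isOpen
  refine (((OrderO.sum hΩ Finset.univ fun j =>
    (H.orderO_heatFlux_sub_fourier j).dir hΩ (0, e j)).add hΩ (OrderO.sum hΩ Finset.univ fun j =>
      (OrderO.sum hΩ Finset.univ fun k => (H.orderO_stress_sub_newtonian j k).mul_macroO hΩ
        (H.velocity k).of_succ).dir hΩ (0, e j))).const_mul hΩ (-1)).congr hΩ fun ε hε z hz => ?_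
  rw [H.energyResidual_eq hε hz
    (fun i j => (H.macroO_shearStress i j).differentiableAt hΩ hε hz)
    (fun i => (H.macroO_fourierFlux i).differentiableAt hΩ hε hz), neg_one_mul]
  rfl

theorem prandtl_eq {ε : ℝ} (hε : ε ∈ Ioo 0 ε₀) {z : SpaceTime} (hz : z ∈ Ω) :
    prandtl R (ε * viscosity ν (τ ε z) (ESFP.pressure R (f ε z)))
      (ε * conductivity R (τ ε z) (ESFP.pressure R (f ε z))) = 3 / (2 * (1 - ν)) := by
  have h1 : 1 - ν ≠ 0 := by linarith [H.ν_lt_one]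
  have h2 : ε ≠ 0 := hε.1.ne'
  have h3 : τ ε z ≠ 0 := (H.τ_pos ε hε z hz).ne'
  -- The pressure must be nonzero to cancel in μ/κ.
  have h4 := (pressure_pos (H.hasMoments hε hz) (H.noVacuum.pos hε hz) H.R_ne_zero
    (H.posDef ε hε z hz)).ne'
  have h5 := H.R_ne_zero
  rw [prandtl, viscosity, conductivity]
  field_simp
  norm_num

end KineticSolution

/-! ### The linearised operator on polynomials -/

theorem dv_eval_scaled (w : V3) (θ : ℝ) (φ : MvPolynomial (Fin 3) ℝ) (l : Fin 3) (v : V3) :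
    dv l (fun v => eval (fun i => scaled w θ v i) φ) v =
      1 / Real.sqrt θ * eval (fun i => scaled w θ v i) (pderiv l φ) := by
  have h1 := hasFDerivAt_eval (x := fun i (v : V3) => scaled w θ v i) (y := v)
    (x' := fun i => (1 / Real.sqrt θ) • (EuclideanSpace.proj i : V3 →L[ℝ] ℝ))
    (fun i => ((EuclideanSpace.proj i : V3 →L[ℝ] ℝ).hasFDerivAt.sub_const (w i)).const_mul _) φ
  rw [dv, h1.fderiv]
  simp [e, mul_comm]

theorem hasFDerivAt_maxwellian (r : ℝ) (w : V3) (θ : ℝ) (v : V3) :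
    HasFDerivAt (maxwellian r w θ) ((r / (2 * Real.pi * θ) ^ (3 / 2 : ℝ)) •
      (Real.exp (-‖v - w‖ ^ 2 / (2 * θ)) • ((2 * θ)⁻¹ • -∑ i,
        centred w (pderiv i normSqPoly) v • (EuclideanSpace.proj i : V3 →L[ℝ] ℝ)))) v := by
  have h1 : maxwellian r w θ = fun v => r / (2 * Real.pi * θ) ^ (3 / 2 : ℝ) *
      Real.exp (-centred w normSqPoly v * (2 * θ)⁻¹) := by
    funext v
    rw [maxwellian, centred_normSqPoly, div_eq_mul_inv (-‖v - w‖ ^ 2)]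
  rw [h1, ← centred_normSqPoly, div_eq_mul_inv (-centred w normSqPoly v)]
  exact ((hasFDerivAt_centred w normSqPoly v).neg.mul_const ((2 * θ)⁻¹)).exp.const_mul _

theorem dv_maxwellian (r : ℝ) (w : V3) {θ : ℝ} (hθ : θ ≠ 0) (l : Fin 3) (v : V3) :
    dv l (maxwellian r w θ) v = -((v l - w l) / θ) * maxwellian r w θ v := by
  have h1 := dv_centred w normSqPoly l v
  rw [dv, (hasFDerivAt_centred w normSqPoly v).fderiv] at h1
  have h2 : centred w (pderiv l normSqPoly) v = 2 * (v l - w l) := by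
    simp [pderiv_normSqPoly, centred]
  rw [dv, (hasFDerivAt_maxwellian r w θ v).fderiv, maxwellian]
  simp only [smul_apply, neg_apply, smul_eq_mul]
  rw [h1, h2]
  field_simp

/-- As ∇M = -((v-w)/θ)M and each v-derivative gives a factor 1/√θ, the operator on functions of V is
Δ - V·∇ (Ornstein–Uhlenbeck), purely symbolic on polynomials. -/
theorem linearised_eval {r : ℝ} (hr : 0 < r) (w : V3) {θ : ℝ} (hθ : 0 < θ)
    (φ : MvPolynomial (Fin 3) ℝ) (v : V3) :
    linearised r w θ (fun v => eval (fun i => scaled w θ v i) φ) v =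
      eval (fun i => scaled w θ v i) (∑ i, (pderiv i (pderiv i φ) - X i * pderiv i φ)) := by
  have hs : Real.sqrt θ ≠ 0 := (Real.sqrt_pos.2 hθ).ne'
  have hss : Real.sqrt θ ^ 2 = θ := Real.sq_sqrt hθ.le
  have hM : maxwellian r w θ v ≠ 0 := by
    rw [maxwellian]
    positivity
  rw [linearised, map_sum, Finset.mul_sum]
  refine Finset.sum_congr rfl fun i _ => ?_
  have hg : dv i (fun v => eval (fun i => scaled w θ v i) φ) = fun v =>
      1 / Real.sqrt θ * eval (fun i => scaled w θ v i) (pderiv i φ) :=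
    funext (dv_eval_scaled w θ φ i)
  have hd : DifferentiableAt ℝ (fun v => eval (fun i => scaled w θ v i) (pderiv i φ)) v :=
    (hasFDerivAt_eval (x := fun i (v : V3) => scaled w θ v i)
      (x' := fun i => (1 / Real.sqrt θ) • (EuclideanSpace.proj i : V3 →L[ℝ] ℝ))
      (fun i => ((EuclideanSpace.proj i : V3 →L[ℝ] ℝ).hasFDerivAt.sub_const (w i)).const_mul _)
      _).differentiableAt
  have hdM := (hasFDerivAt_maxwellian r w θ v).differentiableAt
  have h1 : dv i (fun v => θ * maxwellian r w θ v *
      dv i (fun v => eval (fun i => scaled w θ v i) φ) v) v =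
      θ * dv i (maxwellian r w θ) v * (1 / Real.sqrt θ *
        eval (fun i => scaled w θ v i) (pderiv i φ)) + θ * maxwellian r w θ v *
          (1 / Real.sqrt θ * dv i (fun v => eval (fun i => scaled w θ v i) (pderiv i φ)) v) := by
    rw [hg]
    have h2 : ∀ {a : V3 → ℝ} (c : ℝ), DifferentiableAt ℝ a v →
        DifferentiableAt ℝ (fun v => c * a v) v ∧
          fderiv ℝ (fun v => c * a v) v (e i) = c * fderiv ℝ a v (e i) := fun c ha =>
      ⟨ha.const_mul c, by rw [fderiv_const_mul ha]; rfl⟩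
    rw [dv, fderiv_mul_dir (h2 θ hdM).1 (h2 _ hd).1, (h2 θ hdM).2, (h2 _ hd).2]
    rfl
  rw [h1, dv_maxwellian r w hθ.ne', dv_eval_scaled]
  have h3 : scaled w θ v i = 1 / Real.sqrt θ * (v i - w i) := rfl
  simp only [map_sub, map_mul, eval_X]
  generalize eval (fun i => scaled w θ v i) (pderiv i φ) = a
  generalize eval (fun i => scaled w θ v i) (pderiv i (pderiv i φ)) = b
  rw [h3]
  generalize maxwellian r w θ v = m at *
  have h4 : (1 / Real.sqrt θ) * (1 / Real.sqrt θ) * θ = 1 := by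
    field_simp
    exact hss.symm
  have h5 : 1 / m * m = 1 := by field_simp
  have h6 : θ * (1 / θ) = 1 := by field_simp
  rw [div_eq_mul_one_div (v i - w i)]
  linear_combination (b * θ * (1 / Real.sqrt θ) * (1 / Real.sqrt θ) -
    θ * (1 / θ) * (v i - w i) * (1 / Real.sqrt θ) * a) * h5 + b * h4 -
      (v i - w i) * (1 / Real.sqrt θ) * a * h6

theorem eval_normSqPoly (V : V3) : eval (fun i => V i) normSqPoly = ‖V‖ ^ 2 := by
  rw [EuclideanSpace.real_norm_sq_eq]
  simp [normSqPoly, pow_two]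

/-- The Laplacian of |V|²V_i is 10V_i, and V·∇ multiplies a form by its degree; the coefficient 5/2
is the one making the linear terms match the eigenvalue -3. -/
theorem linearised_vecA {r : ℝ} (hr : 0 < r) (w : V3) {θ : ℝ} (hθ : 0 < θ) (i : Fin 3) (v : V3) :
    linearised r w θ (fun v => vecA i (scaled w θ v)) v = -3 * vecA i (scaled w θ v) := by
  have h : ∀ V : V3, vecA i V =
      eval (fun i => V i) (C (1 / 2) * (X i * normSqPoly) - C (5 / 2) * X i) := fun V => by
    simp only [vecA, map_sub, map_mul, eval_C, eval_X, eval_normSqPoly]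
    ring
  simp only [h]
  rw [linearised_eval hr w hθ]
  generalize scaled w θ v = V
  have hN := eval_normSqPoly V
  rw [EuclideanSpace.real_norm_sq_eq, Fin.sum_univ_three] at hN
  simp only [map_sub, map_add, pderiv_C_mul, pderiv_X_mul_normSqPoly, pderiv_X_eq, pderiv_C,
    pderiv_normSqPoly, pderiv_X_mul_X, map_mul, eval_C, eval_X, Fin.sum_univ_three, hN,
    map_zero]
  fin_cases i <;> simp <;> ring

/-- Being trace-free, B is harmonic, so only -V·∇ acts, by minus the degree. -/
theorem linearised_tensB {r : ℝ} (hr : 0 < r) (w : V3) {θ : ℝ} (hθ : 0 < θ) (i j : Fin 3)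
    (v : V3) :
    linearised r w θ (fun v => tensB i j (scaled w θ v)) v = -2 * tensB i j (scaled w θ v) := by
  have h : ∀ V : V3, tensB i j V =
      eval (fun i => V i) (X i * X j - C (1 / 3 * if i = j then 1 else 0) * normSqPoly) :=
    fun V => by
      simp only [tensB, map_sub, map_mul, eval_C, eval_X, eval_normSqPoly]
      ring
  simp only [h]
  obtain ⟨c, hc⟩ : ∃ c : ℝ, c = 1 / 3 * if i = j then 1 else 0 := ⟨_, rfl⟩
  rw [linearised_eval hr w hθ, ← hc]
  generalize scaled w θ v = V
  have hN := eval_normSqPoly V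
  rw [EuclideanSpace.real_norm_sq_eq, Fin.sum_univ_three] at hN
  simp only [map_sub, map_add, pderiv_C_mul, pderiv_X_eq, pderiv_normSqPoly, pderiv_X_mul_X,
    map_mul, eval_C, eval_X, Fin.sum_univ_three, hN]
  subst hc
  fin_cases i <;> fin_cases j <;> simp <;> ring

end ESFP

theorem mainTheorem4
    (R ν ε₀ : ℝ) (hR : 0 < R) (hν : ν < 1) (hε₀ : 0 < ε₀)
    (Ω : Set SpaceTime) (hΩ : IsOpen Ω)
    (τ : ℝ → SpaceTime → ℝ) (f g : ℝ → SpaceTime → V3 → ℝ)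
    -- relaxation time
    (hτpos : ∀ ε ∈ Ioo 0 ε₀, ∀ z ∈ Ω, 0 < τ ε z)
    (hτ : IsOOneMacro ε₀ Ω τ)
    -- distribution functions, without vacuum in the limit, with `Π` positive definite
    (hf : IsOOneKinetic ε₀ Ω f)
    (hρ : ∀ K ⊆ Ω, IsCompact K → ∃ c > 0, ∀ ε ∈ Ioo 0 ε₀, ∀ z ∈ K, c ≤ density (f ε z))
    (hPi : ∀ ε ∈ Ioo 0 ε₀, ∀ z ∈ Ω, (PiTensor R ν (f ε z)).PosDef)
    -- the kinetic equation
    (hsol : ∀ ε ∈ Ioo 0 ε₀, IsSolution R ν ε (τ ε) Ω (f ε))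
    -- the ansatz `f = G(f) (1 + ε g)` with a deviation of order one
    (hfg : ∀ ε ∈ Ioo 0 ε₀, ∀ z ∈ Ω, ∀ v,
      f ε z v = gaussian R ν (f ε z) v * (1 + ε * g ε z v))
    (hg : IsOOneKinetic ε₀ Ω (fun ε z v => gaussian R ν (f ε z) v * g ε z v)) :
    let ρ := fun (ε : ℝ) (z : SpaceTime) => density (f ε z)
    let u := fun (ε : ℝ) (z : SpaceTime) => velocity (f ε z)
    let E := fun (ε : ℝ) (z : SpaceTime) => energy (f ε z)
    let T := fun (ε : ℝ) (z : SpaceTime) => temperature R (f ε z)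
    let p := fun (ε : ℝ) (z : SpaceTime) => pressure R (f ε z)
    let μ := fun (ε : ℝ) (z : SpaceTime) => viscosity ν (τ ε z) (p ε z)
    let κ := fun (ε : ℝ) (z : SpaceTime) => conductivity R (τ ε z) (p ε z)
    let σ := fun (ε : ℝ) => shearStress (fun z => ε * μ ε z) (u ε)
    let q := fun (ε : ℝ) => fourierFlux (fun z => ε * κ ε z) (T ε)
    -- the macroscopic fields are regular enough for the equations to make sense
    (∀ ε ∈ Ioo 0 ε₀, ContDiffOn ℝ 2 (ρ ε) Ω ∧ ContDiffOn ℝ 2 (u ε) Ω ∧ ContDiffOn ℝ 2 (T ε) Ω) ∧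
    -- the Navier-Stokes equations up to `O(ε²)`
    (∀ ε ∈ Ioo 0 ε₀, ∀ z ∈ Ω, massResidual (ρ ε) (u ε) z = 0) ∧
    (∀ i, IsOEpsSq ε₀ Ω fun ε => momentumResidual (ρ ε) (u ε) (p ε) (σ ε) i) ∧
    (IsOEpsSq ε₀ Ω fun ε => energyResidual (E ε) (u ε) (p ε) (σ ε) (q ε)) ∧
    -- the stress tensor and the heat flux of the kinetic solution up to `O(ε²)`
    (∀ i j, IsOEpsSq ε₀ Ω fun ε z =>
      stress (f ε z) i j - ((if i = j then p ε z else 0) + σ ε i j z)) ∧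
    (∀ i, IsOEpsSq ε₀ Ω fun ε z => heatFlux (f ε z) i - q ε i z) ∧
    -- the Prandtl number
    (∀ ε ∈ Ioo 0 ε₀, ∀ z ∈ Ω, prandtl R (ε * μ ε z) (ε * κ ε z) = 3 / (2 * (1 - ν))) ∧
    -- the eigenfunctions of the linearised operator
    (∀ (r : ℝ) (w : V3) (θ : ℝ), 0 < r → 0 < θ →
      (∀ i v, linearised r w θ (fun v' => vecA i (scaled w θ v')) v =
        -3 * vecA i (scaled w θ v)) ∧
      (∀ i j v, linearised r w θ (fun v' => tensB i j (scaled w θ v')) v =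
        -2 * tensB i j (scaled w θ v))) := by
  -- The deviation used is h = G g, so that f = G + εh and all estimates concern G g rather than g.
  have H : KineticSolution R ν ε₀ Ω τ f (fun ε z v => gaussian R ν (f ε z) v * g ε z v) :=
    { isOpen := hΩ
      R_ne_zero := hR.ne'
      ν_lt_one := hν
      kinO := hf.kinO hΩ
      kinO_dev := hg.kinO hΩ
      noVacuum := hρ
      posDef := hPi
      eq_add := fun ε hε z hz v => by rw [hfg ε hε z hz v]; ring
      τ_pos := hτpos
      macroO_τ := hτ.macroO hΩ
      solution := hsol }
  intro ρ u E T p μ κ σ q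
  refine ⟨fun ε hε => ⟨(H.kinO.density hΩ).contDiffOn hΩ hε,
    contDiffOn_euclidean.2 fun i => (H.velocity i).contDiffOn hΩ hε,
    H.temperature.contDiffOn hΩ hε⟩, fun ε hε z hz => H.mass_balance hε hz,
    fun i => (H.orderO_momentumResidual i).isOEpsSq, H.orderO_energyResidual.isOEpsSq,
    fun i j => ?_, fun i => (H.orderO_heatFlux_sub_fourier i).isOEpsSq,
    fun ε hε z hz => H.prandtl_eq hε hz,
    fun r w θ hr hθ => ⟨linearised_vecA hr w hθ, linearised_tensB hr w hθ⟩⟩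
  refine ((H.orderO_stress_sub_newtonian i j).congr hΩ fun ε _ z _ => ?_).isOEpsSq
  rw [mul_ite, mul_one, mul_zero]
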